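/- Let $n\in\mathbb{N}$ and let $M:\mathbb{C}_+\to M_n(\mathbb{C})$ be a Herglotz matrix, that is, $M$ is analytic on the open upper half-plane $\mathbb{C}_+$ and $\operatorname{Im} M(z)=\frac1{2i}(M(z)-M(z)^*)\ge 0$ for all $z\in\mathbb{C}_+$. Let $$M(z)=C+Dz+\int_{\mathbb{R}}d\Omega(\lambda)\Big(\frac1{\lambda-z}-\frac{\lambda}{1+\lambda^2}\Big),\qquad z\in\mathbb{C}_+,$$ be its Nevanlinna representation, where $C=\operatorname{Re}M(i)$, $D=\lim_{\eta\to\infty}M(i\eta)/(i\eta)\ge 0$, and $\Omega$ is a nonnegative matrix-valued measure on the bounded Borel subsets of $\mathbb{R}$ with $\int_{\mathbb{R}}(x,d\Omega(\lambda)x)(1+\lambda^2)^{-1}<\infty$ for all $x\in\mathbb{C}^n$. Let $\Omega=\Omega_{ac}+\Omega_{sc}+\Omega_{pp}$ be its decomposition into absolutely continuous, singularly continuous and pure point parts with respect to Lebesgue measure $|\cdot|$. A set $S\subseteq\mathbb{R}$ is a support of a measure $\mu$ if $\mu(\mathbb{R}\setminus S)=0$; it is a minimal support if in addition $|S\setminus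 T|=0$ for every support $T\subseteq S$ of $\mu$; it is the smallest support if it is a support contained in every support of $\mu$. For $1\le r\le n$ put $$\begin{aligned} S_{ac,r}&=\{\lambda\in\mathbb{R} : M(\lambda+i0)=\lim_{\varepsilon\downarrow0}M(\lambda+i\varepsilon)\text{ exists finitely and }\operatorname{rank}\operatorname{Im}M(\lambda+i0)=r\},& S_{ac}&=\bigcup_{r=1}^nS_{ac,r},\\ S_{pp,r}&=\{\lambda\in\mathbb{R} : \operatorname{rank}\big(\lim_{\varepsilon\downarrow0}\varepsilon M(\lambda+i\varepsilon)\big)=r\},& S_{pp}&=\bigcup_{r=1}^nS_{pp,r},\\ S_{s}&=\{\lambda\in\mathbb{R} : \lim_{\varepsilon\downarrow0}\operatorname{Im}\operatorname{tr}M(\lambda+i\varepsilon)=+\infty\},\\ S_{sc}&=\{\lambda\in S_s : \lim_{\varepsilon\downarrow0}\varepsilon\operatorname{tr}M(\lambda+i\varepsilon)=0\},& S&=S_{ac}\cup S_s. \end{aligned}$$ Then: (i) $S_{ac}$ is a minimal support of $\Omega_{ac}$. (ii) $S_{sc}$ is a minimal support of $\Omega_{sc}$. (iii) $S_{pp}$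 is the smallest support of $\Omega_{pp}$. (iv) $S$ is a minimal support of $\Omega$. (v) Suppose in addition that $M(z)$ is invertible for all $z\in\mathbb{C}_+$, and let $$\ln M(z)=K+\int_{\mathbb{R}}d\lambda\,\Xi(\lambda)\Big(\frac1{\lambda-z}-\frac{\lambda}{1+\lambda^2}\Big),\qquad z\in\mathbb{C}_+,$$ be the exponential representation of $M$, where $K=\operatorname{Re}\ln M(i)$, the entries of $\Xi$ are measurable, and $0\le\Xi\le I_n$ almost everywhere. Here $\ln A$ is taken with the branch $0\le\arg\le\pi$ of the logarithm on the closed upper half-plane without $0$: it is the matrix $L$ with $e^L=A$ all of whose eigenvalues have imaginary part in $[0,\pi]$. Then $$\widetilde S_{ac}=\{\lambda\in S_{ac} : \lim_{\varepsilon\downarrow0}\ln M(\lambda+i\varepsilon)\text{ exists finitely and }0<\operatorname{tr}\Xi(\lambda)<n\}$$ is a minimal support of $\Omega_{ac}$. -/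

import Mathlib

open MeasureTheory Filter Topology Set
open scoped Matrix ComplexOrder ENNReal

/-! ### Matrices: real and imaginary parts, quadratic forms, logarithm -/

/-- The real part `Re A = (A + A*) / 2` of a square complex matrix. -/
noncomputable def matRe {n : ℕ} (A : Matrix (Fin n) (Fin n) ℂ) : Matrix (Fin n) (Fin n) ℂ :=
  (1 / 2 : ℂ) • (A + Aᴴ)

/-- The imaginary part `Im A = (A - A*) / (2i)` of a square complex matrix. -/
noncomputable def matIm {n : ℕ} (A : Matrix (Fin n) (Fin n) ℂ) : Matrix (Fin n) (Fin n) ℂ :=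
  (1 / (2 * Complex.I)) • (A - Aᴴ)

/-- The (real part of the) quadratic form `(x, A x)`, antilinear in the first factor.
For a nonnegative `A` it equals `(x, A x)`. -/
noncomputable def quadForm {n : ℕ} (x : Fin n → ℂ) (A : Matrix (Fin n) (Fin n) ℂ) : ℝ :=
  (star x ⬝ᵥ (A *ᵥ x)).re

/-- `L = ln A`, for an invertible `A` whose spectrum lies in the closed upper half-plane. The branch
of the scalar logarithm is the one with `0 ≤ arg ≤ π` on the closed upper half-plane without `0`,
so the logarithm of `A` is the matrix `L` with `exp L = A` and all eigenvalues in the strip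
`0 ≤ Im ≤ π`. As `exp` is injective on this strip, `A` has at most one such `L`. -/
def IsMatLog {n : ℕ} (A L : Matrix (Fin n) (Fin n) ℂ) : Prop :=
  NormedSpace.exp L = A ∧ ∀ μ ∈ spectrum ℂ L, 0 ≤ μ.im ∧ μ.im ≤ Real.pi

/-! ### Nonnegative matrix-valued measures on the bounded Borel sets of the real line -/

/-- A nonnegative `n × n` matrix-valued measure on the bounded Borel subsets of `ℝ`: a set function
with nonnegative values, countably additive as long as the union is bounded.
(The values of `toFun` on other sets are irrelevant.) -/
structure MatrixMeasure (n : ℕ) where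
  toFun : Set ℝ → Matrix (Fin n) (Fin n) ℂ
  posSemidef : ∀ X, MeasurableSet X → Bornology.IsBounded X → (toFun X).PosSemidef
  hasSum : ∀ X : ℕ → Set ℝ, (∀ k, MeasurableSet (X k)) → Pairwise (fun k l => Disjoint (X k) (X l)) →
    Bornology.IsBounded (⋃ k, X k) → HasSum (fun k => toFun (X k)) (toFun (⋃ k, X k))

namespace MatrixMeasure

variable {n : ℕ}

instance : CoeFun (MatrixMeasure n) (fun _ => Set ℝ → Matrix (Fin n) (Fin n) ℂ) := ⟨toFun⟩

theorem empty (Ω : MatrixMeasure n) : Ω ∅ = 0 := by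
  have h := Ω.hasSum (fun _ => ∅) (fun _ => MeasurableSet.empty) (fun _ _ _ => by simp) (by simp)
  have h2 := h.summable.tendsto_atTop_zero
  exact tendsto_nhds_unique tendsto_const_nhds h2

/-- Restriction of a matrix-valued measure to a Borel set. -/
def restrict (Ω : MatrixMeasure n) (A : Set ℝ) (hA : MeasurableSet A) : MatrixMeasure n where
  toFun X := Ω (X ∩ A)
  posSemidef X hX hb := Ω.posSemidef _ (hX.inter hA) (hb.subset inter_subset_left)
  hasSum X hX hd hb := by
    have h := Ω.hasSum (fun k => X k ∩ A) (fun k => (hX k).inter hA)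
      (fun k l hkl => (hd hkl).mono inter_subset_left inter_subset_left)
      (hb.subset (iUnion_mono fun k => inter_subset_left))
    rwa [← iUnion_inter] at h

theorem quadForm_nonneg (x : Fin n → ℂ) {A : Matrix (Fin n) (Fin n) ℂ} (hA : A.PosSemidef) :
    0 ≤ quadForm x A :=
  (Complex.le_def.mp (hA.dotProduct_mulVec_nonneg x)).1

theorem continuous_quadForm (x : Fin n → ℂ) :
    Continuous (fun A : Matrix (Fin n) (Fin n) ℂ => quadForm x A) := by
  unfold quadForm
  fun_prop

theorem hasSum_quadForm (Ω : MatrixMeasure n) (x : Fin n → ℂ) (X : ℕ → Set ℝ)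
    (hX : ∀ k, MeasurableSet (X k)) (hd : Pairwise (fun k l => Disjoint (X k) (X l)))
    (hb : Bornology.IsBounded (⋃ k, X k)) :
    ENNReal.ofReal (quadForm x (Ω (⋃ k, X k))) = ∑' k, ENNReal.ofReal (quadForm x (Ω (X k))) := by
  have h := Ω.hasSum X hX hd hb
  let φ : Matrix (Fin n) (Fin n) ℂ →+ ℝ :=
    { toFun := fun A => quadForm x A
      map_zero' := by simp [quadForm]
      map_add' := fun A B => by simp [quadForm, Matrix.add_mulVec] }
  have h2 : HasSum (fun k => quadForm x (Ω (X k))) (quadForm x (Ω (⋃ k, X k))) :=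
    h.map φ (continuous_quadForm x)
  rw [← h2.tsum_eq, ENNReal.ofReal_tsum_of_nonneg _ h2.summable]
  intro k
  exact quadForm_nonneg x (Ω.posSemidef _ (hX k) (hb.subset (subset_iUnion X k)))

/-- The bounded cells `[k, k + 1)`, indexed by the integers, that tile the real line. -/
def cell (k : ℤ) : Set ℝ := Ico (k : ℝ) (k + 1)

theorem measurableSet_cell (k : ℤ) : MeasurableSet (cell k) := measurableSet_Ico

theorem isBounded_cell (k : ℤ) : Bornology.IsBounded (cell k) := Metric.isBounded_Ico _ _

/-- The scalar positive Borel measure `ω_x = (x, Ω x)` on `ℝ`: the countably additive extension of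
`X ↦ (x, Ω(X) x)` from the bounded Borel sets to all Borel sets. -/
noncomputable def quad (Ω : MatrixMeasure n) (x : Fin n → ℂ) : Measure ℝ :=
  Measure.ofMeasurable
    (fun X _ => ∑' k : ℤ, ENNReal.ofReal (quadForm x (Ω (X ∩ cell k))))
    (by simp [Ω.empty, quadForm])
    (by
      intro f hf hd
      rw [ENNReal.tsum_comm]
      refine tsum_congr fun k => ?_
      rw [iUnion_inter]
      exact Ω.hasSum_quadForm x _ (fun i => (hf i).inter (measurableSet_cell k))
        (fun i j hij => (hd hij).mono inter_subset_left inter_subset_left)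
        ((isBounded_cell k).subset (iUnion_subset fun i => inter_subset_right)))

theorem quad_apply (Ω : MatrixMeasure n) (x : Fin n → ℂ) {X : Set ℝ} (hX : MeasurableSet X)
    (hb : Bornology.IsBounded X) :
    Ω.quad x X = ENNReal.ofReal (quadForm x (Ω X)) := by
  rw [quad, Measure.ofMeasurable_apply _ hX]
  have hU : (⋃ m : ℕ, X ∩ cell (Equiv.intEquivNat.symm m)) = X := by
    rw [← inter_iUnion, Equiv.intEquivNat.symm.surjective.iUnion_comp cell]
    have : (⋃ k : ℤ, cell k) = univ := iUnion_Ico_intCast ℝ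
    rw [this, inter_univ]
  have h := Ω.hasSum_quadForm x (fun m : ℕ => X ∩ cell (Equiv.intEquivNat.symm m))
    (fun m => hX.inter (measurableSet_cell _))
    (fun k l hkl => ((pairwise_disjoint_Ico_intCast ℝ)
      (Equiv.intEquivNat.symm.injective.ne hkl)).mono inter_subset_right inter_subset_right)
    (by rw [hU]; exact hb)
  rw [hU] at h
  rw [h, Equiv.intEquivNat.symm.tsum_eq
    (fun k : ℤ => ENNReal.ofReal (quadForm x (Ω (X ∩ cell k))))]

/-- The trace measure `ω^tr = Ω₁₁ + ⋯ + Ωₙₙ`. -/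
noncomputable def trace (Ω : MatrixMeasure n) : Measure ℝ := ∑ j, Ω.quad (Pi.single j 1)

theorem trace_apply (Ω : MatrixMeasure n) {X : Set ℝ} (hX : MeasurableSet X)
    (hb : Bornology.IsBounded X) : Ω.trace X = ENNReal.ofReal (Ω X).trace.re := by
  have hq : ∀ j, quadForm (Pi.single j 1) (Ω X) = (Ω X j j).re := fun j => by
    simp [quadForm]
  rw [trace, Measure.finsetSum_apply]
  simp_rw [Ω.quad_apply _ hX hb]
  rw [← ENNReal.ofReal_sum_of_nonneg (fun j _ => quadForm_nonneg _ (Ω.posSemidef X hX hb))]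
  simp [hq, Matrix.trace]

theorem trace_eq_zero_iff (Ω : MatrixMeasure n) {X : Set ℝ} (hX : MeasurableSet X)
    (hb : Bornology.IsBounded X) : Ω.trace X = 0 ↔ Ω X = 0 := by
  have hp := Ω.posSemidef X hX hb
  rw [Ω.trace_apply hX hb, ENNReal.ofReal_eq_zero, ← hp.trace_eq_zero_iff]
  have h0 := Complex.le_def.mp hp.trace_nonneg
  constructor
  · intro h
    exact Complex.ext (le_antisymm h h0.1) h0.2.symm
  · intro h
    simp [h]

instance (Ω : MatrixMeasure n) : SigmaFinite Ω.trace := by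
  refine ⟨⟨⟨fun m => cell (Equiv.intEquivNat.symm m), fun _ => trivial, fun m => ?_, ?_⟩⟩⟩
  · rw [Ω.trace_apply (measurableSet_cell _) (isBounded_cell _)]
    exact ENNReal.ofReal_lt_top
  · rw [Equiv.intEquivNat.symm.surjective.iUnion_comp cell]
    exact iUnion_Ico_intCast ℝ

/-- The integral `∫ f dΩ` of a scalar function, entrywise: `∫ f dΩ_{j,k}` is obtained from the
scalar measures `ω_x = (x, Ω x)` by polarization. -/
noncomputable def integral (Ω : MatrixMeasure n) (f : ℝ → ℂ) : Matrix (Fin n) (Fin n) ℂ :=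
  Matrix.of fun j k =>
    let e : Fin n → Fin n → ℂ := fun i => Pi.single i 1
    (1 / 4 : ℂ) * ((∫ t, f t ∂(Ω.quad (e j + e k))) - (∫ t, f t ∂(Ω.quad (e j - e k)))
      + Complex.I * (∫ t, f t ∂(Ω.quad (e j - Complex.I • e k)))
      - Complex.I * (∫ t, f t ∂(Ω.quad (e j + Complex.I • e k))))

/-! ### Lebesgue decomposition -/

/-- The set of atoms of `Ω`. -/
def atoms (Ω : MatrixMeasure n) : Set ℝ := {t | Ω {t} ≠ 0}

theorem countable_atoms (Ω : MatrixMeasure n) : Ω.atoms.Countable := by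
  have h := Measure.countable_meas_pos_of_disjoint_iUnion (μ := Ω.trace)
    (As := fun t : ℝ => ({t} : Set ℝ)) (fun t => measurableSet_singleton t)
    (fun s t hst => by simpa using hst)
  refine h.mono fun t ht => ?_
  have h2 := (Ω.trace_eq_zero_iff (measurableSet_singleton t) Bornology.isBounded_singleton).not.mpr
    ht
  exact pos_iff_ne_zero.mpr h2

/-- There is a Lebesgue null set `N` that carries the singular part of `Ω`: off `N`, the measure
`Ω` vanishes on every Lebesgue null set. -/
theorem exists_singular_carrier (Ω : MatrixMeasure n) : ∃ N : Set ℝ, MeasurableSet N ∧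
    volume N = 0 ∧
    ∀ X, MeasurableSet X → Bornology.IsBounded X → volume X = 0 → Ω (X \ N) = 0 := by
  obtain ⟨S, hS, hS1, hS2⟩ := Measure.mutuallySingular_singularPart Ω.trace volume
  refine ⟨Sᶜ, hS.compl, hS2, fun X hX hb hv => ?_⟩
  have hm : MeasurableSet (X \ Sᶜ) := hX.diff hS.compl
  rw [← Ω.trace_eq_zero_iff hm (hb.subset sdiff_subset),
    ← Measure.singularPart_add_rnDeriv Ω.trace volume, Measure.add_apply]
  have h1 : Ω.trace.singularPart volume (X \ Sᶜ) = 0 :=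
    measure_mono_null (by simp) hS1
  have h2 : volume.withDensity (Ω.trace.rnDeriv volume) (X \ Sᶜ) = 0 :=
    withDensity_absolutelyContinuous _ _ (measure_mono_null sdiff_subset hv)
  rw [h1, h2, add_zero]

/-- A Lebesgue null Borel set that carries the singular part of `Ω`. -/
noncomputable def singularCarrier (Ω : MatrixMeasure n) : Set ℝ := Ω.exists_singular_carrier.choose

theorem measurableSet_singularCarrier (Ω : MatrixMeasure n) : MeasurableSet Ω.singularCarrier :=
  Ω.exists_singular_carrier.choose_spec.1

theorem volume_singularCarrier (Ω : MatrixMeasure n) : volume Ω.singularCarrier = 0 :=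
  Ω.exists_singular_carrier.choose_spec.2.1

theorem apply_diff_singularCarrier (Ω : MatrixMeasure n) {X : Set ℝ} (hX : MeasurableSet X)
    (hb : Bornology.IsBounded X) (h0 : volume X = 0) : Ω (X \ Ω.singularCarrier) = 0 :=
  Ω.exists_singular_carrier.choose_spec.2.2 X hX hb h0

/-- The absolutely continuous part `Ω_ac` in the Lebesgue decomposition
`Ω = Ω_ac + Ω_sc + Ω_pp` with respect to Lebesgue measure. -/
noncomputable def acPart (Ω : MatrixMeasure n) : MatrixMeasure n :=
  Ω.restrict Ω.singularCarrierᶜ Ω.measurableSet_singularCarrier.compl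

/-- The singularly continuous part `Ω_sc`: the singular part without its atoms. -/
noncomputable def scPart (Ω : MatrixMeasure n) : MatrixMeasure n :=
  Ω.restrict (Ω.singularCarrier \ Ω.atoms)
    (Ω.measurableSet_singularCarrier.diff Ω.countable_atoms.measurableSet)

/-- The pure point part `Ω_pp`. -/
noncomputable def ppPart (Ω : MatrixMeasure n) : MatrixMeasure n :=
  Ω.restrict Ω.atoms Ω.countable_atoms.measurableSet

theorem atoms_subset_singularCarrier (Ω : MatrixMeasure n) : Ω.atoms ⊆ Ω.singularCarrier := by
  intro t ht
  by_contra h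
  apply ht
  have h2 := Ω.apply_diff_singularCarrier (measurableSet_singleton t) Bornology.isBounded_singleton
    (by simp)
  rwa [sdiff_eq_left.mpr (by simpa using h)] at h2

theorem add_apply (Ω : MatrixMeasure n) {X Y : Set ℝ} (hX : MeasurableSet X) (hY : MeasurableSet Y)
    (hd : Disjoint X Y) (hb : Bornology.IsBounded (X ∪ Y)) : Ω (X ∪ Y) = Ω X + Ω Y := by
  let f : ℕ → Set ℝ := fun k => if k = 0 then X else if k = 1 then Y else ∅
  have hU : (⋃ k, f k) = X ∪ Y := by
    ext t
    simp only [mem_iUnion, mem_union, f]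
    constructor
    · rintro ⟨k, hk⟩
      split_ifs at hk <;> simp_all
    · rintro (h | h)
      · exact ⟨0, by simpa using h⟩
      · exact ⟨1, by simpa using h⟩
  have h := Ω.hasSum f (fun k => by simp only [f]; split_ifs <;> simp [*])
    (fun k l hkl => by
      simp only [f]
      split_ifs <;> simp_all [disjoint_comm]) (by rwa [hU])
  rw [hU] at h
  refine h.unique ?_
  have h3 := hasSum_sum_of_ne_finset_zero (L := SummationFilter.unconditional ℕ)
    (f := fun k => Ω (f k)) (s := {0, 1}) (fun k hk => by
    simp only [Finset.mem_insert, Finset.mem_singleton, not_or] at hk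
    simp [f, hk.1, hk.2, Ω.empty])
  simpa [f] using h3

/-- The three parts sum to `Ω`. -/
theorem acPart_add_scPart_add_ppPart (Ω : MatrixMeasure n) {X : Set ℝ} (hX : MeasurableSet X)
    (hb : Bornology.IsBounded X) : Ω.acPart X + Ω.scPart X + Ω.ppPart X = Ω X := by
  have hN := Ω.measurableSet_singularCarrier
  have hA := Ω.countable_atoms.measurableSet
  have hs := Ω.atoms_subset_singularCarrier
  change Ω (X ∩ Ω.singularCarrierᶜ) + Ω (X ∩ (Ω.singularCarrier \ Ω.atoms)) + Ω (X ∩ Ω.atoms) = Ω X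
  rw [← Ω.add_apply (hX.inter hN.compl) (hX.inter (hN.diff hA)), ← Ω.add_apply _ (hX.inter hA)]
  · congr 1
    ext t
    have := @hs t
    simp only [mem_union, mem_inter_iff, mem_compl_iff, Set.mem_sdiff]
    tauto
  · rw [Set.disjoint_left]
    intro t
    have := @hs t
    simp only [mem_union, mem_inter_iff, mem_compl_iff, Set.mem_sdiff]
    tauto
  · exact hb.subset (by intro t; simp only [mem_union, mem_inter_iff]; tauto)
  · exact (hX.inter hN.compl).union (hX.inter (hN.diff hA))
  · rw [Set.disjoint_left]
    intro t
    simp only [mem_inter_iff, mem_compl_iff, Set.mem_sdiff]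
    tauto
  · exact hb.subset (by intro t; simp only [mem_union, mem_inter_iff]; tauto)

/-! ### Supports -/

/-- `A` is a null set of `Ω`: it lies in a Borel set on all of whose bounded Borel subsets `Ω`
vanishes. -/
def IsNull (Ω : MatrixMeasure n) (A : Set ℝ) : Prop :=
  ∃ B, MeasurableSet B ∧ A ⊆ B ∧
    ∀ X, MeasurableSet X → Bornology.IsBounded X → X ⊆ B → Ω X = 0

/-- `S` is a support of `Ω`: `Ω (ℝ \ S) = 0`. -/
def IsSupport (Ω : MatrixMeasure n) (S : Set ℝ) : Prop := Ω.IsNull Sᶜ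

/-- `S` is a minimal support of `Ω` (relative to Lebesgue measure): a support such that `S \ T` is
Lebesgue null for every smaller support `T ⊆ S`. -/
def IsMinimalSupport (Ω : MatrixMeasure n) (S : Set ℝ) : Prop :=
  Ω.IsSupport S ∧ ∀ T, T ⊆ S → Ω.IsSupport T → volume (S \ T) = 0

/-- `S` is the smallest support of `Ω`: a support contained in every other support. -/
def IsSmallestSupport (Ω : MatrixMeasure n) (S : Set ℝ) : Prop :=
  Ω.IsSupport S ∧ ∀ T, Ω.IsSupport T → S ⊆ T

end MatrixMeasure

/-! ### Herglotz matrices and their representations -/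

/-- `M` is a matrix-valued Herglotz function: analytic on the open upper half-plane with
`Im M(z) ≥ 0` there. (The values of `M` elsewhere are irrelevant.) -/
def IsHerglotzMatrix {n : ℕ} (M : ℂ → Matrix (Fin n) (Fin n) ℂ) : Prop :=
  (∀ j k, DifferentiableOn ℂ (fun z => M z j k) {z | 0 < z.im}) ∧
    ∀ z : ℂ, 0 < z.im → (matIm (M z)).PosSemidef

/-- The kernel `(λ - z)⁻¹ - λ / (1 + λ²)`. -/
noncomputable def herglotzKernel (z : ℂ) (t : ℝ) : ℂ :=
  ((t : ℂ) - z)⁻¹ - (t : ℂ) / (1 + (t : ℂ) ^ 2)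

/-- The Riesz–Herglotz (Nevanlinna) representation of `M`:
`M(z) = C + D z + ∫ dΩ(λ) ((λ - z)⁻¹ - λ (1 + λ²)⁻¹)` on the upper half-plane, with
`∫ (x, dΩ(λ) x) (1 + λ²)⁻¹ < ∞` for all `x`, `C = Re M(i)` and `D = lim M(iη) / (iη) ≥ 0`. -/
structure HasHerglotzRepresentation {n : ℕ} (M : ℂ → Matrix (Fin n) (Fin n) ℂ)
    (C D : Matrix (Fin n) (Fin n) ℂ) (Ω : MatrixMeasure n) : Prop where
  lintegral_lt_top : ∀ x : Fin n → ℂ, ∫⁻ t : ℝ, ENNReal.ofReal ((1 + t ^ 2)⁻¹) ∂(Ω.quad x) < ∞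
  eq_integral : ∀ z : ℂ, 0 < z.im → M z = C + z • D + Ω.integral (herglotzKernel z)
  C_eq : C = matRe (M Complex.I)
  D_posSemidef : D.PosSemidef
  tendsto_D : Tendsto (fun η : ℝ => (Complex.I * (η : ℂ))⁻¹ • M (Complex.I * (η : ℂ))) atTop (𝓝 D)

/-- The exponential representation of `M`:
`ln M(z) = K + ∫ dλ Ξ(λ) ((λ - z)⁻¹ - λ (1 + λ²)⁻¹)` on the upper half-plane, with `Ξ` measurable,
`0 ≤ Ξ ≤ I` almost everywhere (so that the entries of `Ξ` are in `L^∞`), and `K = Re ln M(i)`. -/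
structure HasExponentialRepresentation {n : ℕ} (M : ℂ → Matrix (Fin n) (Fin n) ℂ)
    (K : Matrix (Fin n) (Fin n) ℂ) (Ξ : ℝ → Matrix (Fin n) (Fin n) ℂ) : Prop where
  aestronglyMeasurable : ∀ j k, AEStronglyMeasurable (fun t => Ξ t j k) volume
  nonneg : ∀ᵐ t, (Ξ t).PosSemidef
  le_one : ∀ᵐ t, (1 - Ξ t).PosSemidef
  log_eq_integral : ∀ z : ℂ, 0 < z.im →
    IsMatLog (M z) (K + Matrix.of fun j k => ∫ t : ℝ, Ξ t j k * herglotzKernel z t)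
  K_eq : ∃ L, IsMatLog (M Complex.I) L ∧ K = matRe L

/-! ### Boundary values -/

/-- The point `λ + iε`. -/
noncomputable def bdryPt (t ε : ℝ) : ℂ := (t : ℂ) + (ε : ℂ) * Complex.I

/-- `S_{ac,r}`: the points `λ` at which `M(λ + i0) = lim_{ε ↓ 0} M(λ + iε)` exists finitely and
`Im M(λ + i0)` has rank `r`. -/
def suppACRank {n : ℕ} (M : ℂ → Matrix (Fin n) (Fin n) ℂ) (r : ℕ) : Set ℝ :=
  {t | ∃ A, Tendsto (fun ε : ℝ => M (bdryPt t ε)) (𝓝[>] 0) (𝓝 A) ∧ (matIm A).rank = r}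

/-- `S_ac`, the union of `S_{ac,r}` over `1 ≤ r ≤ n`. -/
def suppAC {n : ℕ} (M : ℂ → Matrix (Fin n) (Fin n) ℂ) : Set ℝ :=
  ⋃ r ∈ Icc 1 n, suppACRank M r

/-- `S_{pp,r}`: the points `λ` at which `lim_{ε ↓ 0} ε M(λ + iε)` has rank `r`. -/
def suppPPRank {n : ℕ} (M : ℂ → Matrix (Fin n) (Fin n) ℂ) (r : ℕ) : Set ℝ :=
  {t | ∃ A, Tendsto (fun ε : ℝ => (ε : ℂ) • M (bdryPt t ε)) (𝓝[>] 0) (𝓝 A) ∧ A.rank = r}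

/-- `S_pp`, the union of `S_{pp,r}` over `1 ≤ r ≤ n`. -/
def suppPP {n : ℕ} (M : ℂ → Matrix (Fin n) (Fin n) ℂ) : Set ℝ :=
  ⋃ r ∈ Icc 1 n, suppPPRank M r

/-- `S_s`: the points `λ` with `lim_{ε ↓ 0} Im tr M(λ + iε) = +∞`. -/
def suppS {n : ℕ} (M : ℂ → Matrix (Fin n) (Fin n) ℂ) : Set ℝ :=
  {t | Tendsto (fun ε : ℝ => (M (bdryPt t ε)).trace.im) (𝓝[>] 0) atTop}

/-- `S_sc`: the points `λ` of `S_s` with `lim_{ε ↓ 0} ε tr M(λ + iε) = 0`. -/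
def suppSC {n : ℕ} (M : ℂ → Matrix (Fin n) (Fin n) ℂ) : Set ℝ :=
  {t ∈ suppS M | Tendsto (fun ε : ℝ => (ε : ℂ) * (M (bdryPt t ε)).trace) (𝓝[>] 0) (𝓝 0)}

/-- `S = S_ac ∪ S_s`. -/
def suppAll {n : ℕ} (M : ℂ → Matrix (Fin n) (Fin n) ℂ) : Set ℝ := suppAC M ∪ suppS M

/-- The points `λ` of `S_ac` at which `ln M(λ + i0) = lim_{ε ↓ 0} ln M(λ + iε)` exists finitely and
`0 < tr Ξ(λ) < n`. -/
def suppACTilde {n : ℕ} (M : ℂ → Matrix (Fin n) (Fin n) ℂ)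
    (Ξ : ℝ → Matrix (Fin n) (Fin n) ℂ) : Set ℝ :=
  {t ∈ suppAC M |
    (∃ (L : ℝ → Matrix (Fin n) (Fin n) ℂ) (A : Matrix (Fin n) (Fin n) ℂ),
      (∀ ε : ℝ, 0 < ε → IsMatLog (M (bdryPt t ε)) (L ε)) ∧ Tendsto L (𝓝[>] 0) (𝓝 A)) ∧
    0 < (Ξ t).trace.re ∧ (Ξ t).trace.re < n}

/-!
The set functions `Ω`, `Ω_ac`, `Ω_sc`, `Ω_pp` have the same null sets as their trace measures, and
`tr M(z)` is, up to an affine term, the Borel transform of the trace measure `μ` of `Ω`. So the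
theorem is about the boundary behaviour of the scalar Herglotz function `tr M`, plus the almost
everywhere existence of the limit of the whole matrix `M(λ + iε)`.

* `Im tr M(λ + iε)` is a Poisson integral of `μ`. It converges to `π` times the symmetric derivative
  of `μ` at `λ` wherever that exists in `[0, ∞]` (`tendsto_poissonLIntegral`). By Besicovitch's
  differentiation theorem the derivative is the density of `μ` Lebesgue-almost everywhere, and it is
  `∞` at almost every point with respect to the singular part of `μ`. This gives that `S_s` is a
  Lebesgue null set carrying the singular part.
* `ε M(λ + iε)` converges at every `λ`, and the trace of the limit is `i μ({λ})`. Hence `S_pp` is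
  the set of atoms, and `S_sc` is `S_s` without the atoms.
* The entries of `M` are combinations of scalar Borel transforms `m` by polarization, and each of
  these has boundary values almost everywhere (`ae_exists_tendsto_borelTransform`): `exp (i m)` is
  bounded, so that Fatou's theorem applies (`ae_exists_tendsto_of_bounded`); its boundary values are
  not zero, as `Im m` has finite limits; and a continuous path whose exponential has a nonzero limit
  converges itself. Fatou's theorem is obtained from the Poisson formula by an integration by parts,
  which replaces the boundary values of the function by a Lipschitz primitive of them.
* At a boundary value `A` of `M` the matrix `Im A` is nonnegative, so it vanishes exactly if its
  trace, `π` times the density of `μ`, does. Hence `S_ac` is the set where the density is not zero,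
  up to a Lebesgue null set, and every set with this property is a minimal support of `Ω_ac`
  (`MatrixMeasure.isMinimalSupport_acPart`).
* For the logarithm, the same boundary results applied to the densities `Ξ_jk` show that almost
  everywhere `ln M(λ + i0)` exists and has imaginary part `π Ξ(λ)`. If `tr Ξ(λ)` is `0` or `n`, then
  `Ξ(λ)` is `0` or the identity and `M(λ + i0)` is Hermitian, which is excluded on `S_ac`. So the
  extra conditions that define the smaller set remove only a Lebesgue null set from `S_ac`.
-/

/-! ### Bounded analytic functions on the upper half-plane -/

theorem integrable_inv_sub_sq_add_sq (x : ℝ) {y : ℝ} (hy : 0 < y) :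
    Integrable (fun t : ℝ => ((t - x) ^ 2 + y ^ 2)⁻¹) := by
  have h := ((integrable_inv_one_add_sq.comp_div hy.ne').comp_sub_right x).const_mul (y ^ 2)⁻¹
  refine h.congr (Eventually.of_forall fun t => ?_)
  simp only
  field_simp
  ring

theorem integral_inv_sub_sq_add_sq (x : ℝ) {y : ℝ} (hy : 0 < y) :
    ∫ t : ℝ, ((t - x) ^ 2 + y ^ 2)⁻¹ = Real.pi / y := by
  have h1 : ∀ t : ℝ, ((t - x) ^ 2 + y ^ 2)⁻¹ = (y ^ 2)⁻¹ * (1 + ((t - x) / y) ^ 2)⁻¹ := by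
    intro t
    field_simp
    ring
  simp_rw [h1]
  rw [integral_const_mul, integral_sub_right_eq_self (fun t : ℝ => (1 + (t / y) ^ 2)⁻¹) x,
    Measure.integral_comp_div (fun t : ℝ => (1 + t ^ 2)⁻¹) y, integral_univ_inv_one_add_sq,
    abs_of_pos hy, smul_eq_mul]
  field_simp

/-- The Poisson formula on the half-plane for a bounded function that is analytic across the real
line. The difference quotient of `G` at `z`, divided by `w - z̄`, is analytic and decays like
`|w|⁻²`, so its integral over the real line vanishes. -/
theorem poisson_formula {G : ℂ → ℂ} {δ B : ℝ} (hδ : 0 < δ)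
    (hG : DifferentiableOn ℂ G {w | -δ < w.im}) (hB : ∀ w : ℂ, 0 ≤ w.im → ‖G w‖ ≤ B)
    (x : ℝ) {y : ℝ} (hy : 0 < y) :
    ∫ t : ℝ, (((t - x) ^ 2 + y ^ 2)⁻¹ : ℝ) • G t = (Real.pi / y) • G (bdryPt x y) := by
  set z : ℂ := bdryPt x y with hz
  have hzre : z.re = x := by simp [hz, bdryPt]
  have hzim : z.im = y := by simp [hz, bdryPt]
  have hB0 : 0 ≤ B := (norm_nonneg _).trans (hB z (by rw [hzim]; exact hy.le))
  have hopen : IsOpen {w : ℂ | -δ < w.im} := isOpen_lt continuous_const Complex.continuous_im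
  set E : ℂ → ℂ := fun w => dslope G z w / (w - (starRingEnd ℂ) z) with hE
  have hEd : DifferentiableOn ℂ E {w | 0 ≤ w.im} := by
    have h1 : DifferentiableOn ℂ (dslope G z) {w | -δ < w.im} :=
      (Complex.differentiableOn_dslope
        (hopen.mem_nhds (by simp only [mem_ofPred_eq]; linarith))).mpr hG
    refine (h1.mono fun w hw => ?_).div (by fun_prop) fun w hw h => ?_
    · simp only [mem_ofPred_eq] at hw ⊢; linarith
    · have := congrArg Complex.im h
      simp only [mem_ofPred_eq] at hw
      simp [hzim] at this
      linarith
  have hEeq : ∀ w, w ≠ z → E w = (G w - G z) / ((w - z) * (w - (starRingEnd ℂ) z)) := by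
    intro w hw
    simp only [hE, dslope_of_ne _ hw, slope_def_field]
    rw [div_div]
  have hbound : ∀ w : ℂ, 0 ≤ w.im → 2 * ‖z‖ + 1 ≤ ‖w‖ → ‖E w‖ ≤ 8 * B / ‖w‖ ^ 2 := by
    intro w hw hwn
    have hn0 := norm_nonneg z
    have hne : w ≠ z := by rintro rfl; linarith
    have h1 : ‖w‖ / 2 ≤ ‖w - z‖ := by have := norm_sub_norm_le w z; linarith
    have h2 : ‖w‖ / 2 ≤ ‖w - (starRingEnd ℂ) z‖ := by
      have := norm_sub_norm_le w ((starRingEnd ℂ) z)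
      rw [Complex.norm_conj] at this; linarith
    have hw0 : 0 < ‖w‖ := by linarith
    have h3 : ‖G w - G z‖ ≤ 2 * B := by
      have := norm_sub_le (G w) (G z)
      have := hB w hw
      have := hB z (by rw [hzim]; exact hy.le)
      linarith
    rw [hEeq w hne, norm_div, norm_mul]
    calc _ ≤ 2 * B / (‖w‖ / 2 * (‖w‖ / 2)) := by gcongr
      _ = _ := by field_simp; ring
  have hEreal : ∀ t : ℝ, E t = (((t - x) ^ 2 + y ^ 2)⁻¹ : ℝ) • (G t - G z) := by
    intro t
    have hne : (t : ℂ) ≠ z := fun h => by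
      have := congrArg Complex.im h
      simp [hzim] at this
      linarith
    rw [hEeq _ hne, div_eq_inv_mul, Complex.real_smul]
    congr 1
    rw [Complex.ofReal_inv]
    congr 1
    simp only [hz, bdryPt, map_add, map_mul, Complex.conj_ofReal, Complex.conj_I]
    push_cast
    linear_combination (- (y:ℂ)^2) * Complex.I_sq
  have hcont : Continuous (fun t : ℝ => G t) := by
    rw [continuous_iff_continuousAt]
    intro t
    have : ContinuousAt G t :=
      (hG.differentiableAt (hopen.mem_nhds (by simpa using hδ))).continuousAt
    exact this.comp (f := fun t : ℝ => (t : ℂ)) Complex.continuous_ofReal.continuousAt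
  have hP := integrable_inv_sub_sq_add_sq x hy
  have hPG : Integrable (fun t : ℝ => (((t - x) ^ 2 + y ^ 2)⁻¹ : ℝ) • G t) :=
    hP.smul_bdd B hcont.aestronglyMeasurable
      (Eventually.of_forall fun t => hB _ (by simp))
  have hPz : Integrable (fun t : ℝ => (((t - x) ^ 2 + y ^ 2)⁻¹ : ℝ) • G z) := hP.smul_const _
  have hEint : Integrable (fun t : ℝ => E t) := by
    simp_rw [hEreal, smul_sub]
    exact hPG.sub hPz
  have hlim := intervalIntegral_tendsto_integral hEint tendsto_neg_atTop_atBot tendsto_id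
  have hlim0 : Tendsto (fun R : ℝ => ∫ t in (-R)..R, E t) atTop (𝓝 0) := by
    have h0 : Tendsto (fun R : ℝ => 32 * B / R) atTop (𝓝 0) :=
      tendsto_const_nhds.div_atTop tendsto_id
    refine squeeze_zero_norm' ?_ h0
    filter_upwards [eventually_ge_atTop (2 * ‖z‖ + 1)] with R hR
    have hn0 := norm_nonneg z
    have hR0 : 0 < R := by linarith
    have hb : ∀ w : ℂ, 0 ≤ w.im → R ≤ ‖w‖ → ‖E w‖ ≤ 8 * B / R ^ 2 := by
      intro w hw hRw
      refine (hbound w hw (hR.trans hRw)).trans ?_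
      gcongr
    have hrect := Complex.integral_boundary_rect_eq_zero_of_differentiableOn E (-R : ℝ)
      (bdryPt R R) (hEd.mono fun w hw => by
        have h2 := hw.2
        simp only [bdryPt, Complex.ofReal_im, Complex.add_im, Complex.mul_im, Complex.ofReal_re,
          Complex.I_im, Complex.I_re, mul_one, mul_zero, zero_add, add_zero, mem_preimage] at h2
        rw [uIcc_of_le hR0.le] at h2
        exact h2.1)
    simp only [bdryPt, Complex.ofReal_im, Complex.add_im, Complex.mul_im, Complex.ofReal_re,
          Complex.I_im, Complex.I_re, mul_one, mul_zero, zero_add, add_zero, Complex.add_re,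
          Complex.mul_re, sub_zero, Complex.ofReal_zero, zero_mul] at hrect
    have i1 : ‖∫ t in (-R)..R, E (t + R * Complex.I)‖ ≤ 8 * B / R ^ 2 * |R - (-R)| := by
      refine intervalIntegral.norm_integral_le_of_norm_le_const fun t _ =>
        hb _ (by simp [hR0.le]) ?_
      have := Complex.abs_im_le_norm (t + R * Complex.I)
      simpa [abs_of_pos hR0] using this
    have i2 : ‖∫ s in (0 : ℝ)..R, E (R + s * Complex.I)‖ ≤ 8 * B / R ^ 2 * |R - 0| := by
      refine intervalIntegral.norm_integral_le_of_norm_le_const fun s hs => hb _ ?_ ?_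
      · rw [uIoc_of_le hR0.le] at hs
        simpa using hs.1.le
      · have := Complex.abs_re_le_norm (R + s * Complex.I)
        simpa [abs_of_pos hR0] using this
    have i3 : ‖∫ s in (0 : ℝ)..R, E ((-R : ℝ) + s * Complex.I)‖ ≤ 8 * B / R ^ 2 * |R - 0| := by
      refine intervalIntegral.norm_integral_le_of_norm_le_const fun s hs => hb _ ?_ ?_
      · rw [uIoc_of_le hR0.le] at hs
        simpa using hs.1.le
      · have := Complex.abs_re_le_norm ((-R : ℝ) + s * Complex.I)
        simpa [abs_of_pos hR0] using this
    have heq : ∫ t in (-R)..R, E t = (∫ t in (-R)..R, E (t + R * Complex.I))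
        - Complex.I • (∫ s in (0 : ℝ)..R, E (R + s * Complex.I))
        + Complex.I • (∫ s in (0 : ℝ)..R, E ((-R : ℝ) + s * Complex.I)) := by
      linear_combination hrect
    rw [heq]
    refine (norm_add_le _ _).trans ((add_le_add_left (norm_sub_le _ _) _).trans ?_)
    rw [norm_smul, norm_smul, Complex.norm_I, one_mul, one_mul]
    refine (add_le_add (add_le_add i1 i2) i3).trans (le_of_eq ?_)
    rw [sub_neg_eq_add, sub_zero, abs_of_pos hR0, abs_of_pos (by linarith)]
    field_simp
    ring
  have hzero := tendsto_nhds_unique hlim hlim0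
  simp_rw [hEreal, smul_sub] at hzero
  rw [integral_sub hPG hPz, integral_smul_const, integral_inv_sub_sq_add_sq x hy,
    sub_eq_zero] at hzero
  exact hzero

/-- The primitives of `F` along the lines `Im w = 1 / (k + 1)` converge, as `k → ∞`, to a Lipschitz
function on the real line, a primitive of the boundary values of `F` that are yet to be found. -/
theorem exists_boundary_primitive {F : ℂ → ℂ} {B : ℝ}
    (hF : DifferentiableOn ℂ F {w | 0 < w.im}) (hB : ∀ w : ℂ, 0 < w.im → ‖F w‖ ≤ B) :
    ∃ Φ : ℝ → ℂ, (∀ s t, ‖Φ t - Φ s‖ ≤ B * |t - s|) ∧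
      ∀ s t, Tendsto (fun k : ℕ => ∫ r in s..t, F (bdryPt r (1 / ((k : ℝ) + 1)))) atTop
        (𝓝 (Φ t - Φ s)) := by
  have hB0 : 0 ≤ B := (norm_nonneg _).trans (hB Complex.I (by simp))
  have hcont : ∀ ε : ℝ, 0 < ε → Continuous (fun t : ℝ => F (bdryPt t ε)) := by
    intro ε hε
    refine hF.continuousOn.comp_continuous (by unfold bdryPt; fun_prop) fun t => ?_
    simpa [bdryPt] using hε
  have hdiff : ∀ (t ε δ : ℝ), 0 < ε → 0 < δ →
      dist (∫ r in (0 : ℝ)..t, F (bdryPt r ε)) (∫ r in (0 : ℝ)..t, F (bdryPt r δ))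
        ≤ 2 * B * |δ - ε| := by
    intro t ε δ hε hδ
    have hrect := Complex.integral_boundary_rect_eq_zero_of_differentiableOn F (bdryPt 0 ε)
      (bdryPt t δ) (hF.mono fun w hw => by
        have h2 := hw.2
        simp only [bdryPt, Complex.ofReal_im, Complex.add_im, Complex.mul_im, Complex.ofReal_re,
          Complex.I_im, Complex.I_re, mul_one, mul_zero, zero_add, add_zero, mem_preimage] at h2
        exact (lt_min hε hδ).trans_le h2.1)
    simp only [bdryPt, Complex.ofReal_im, Complex.add_im, Complex.mul_im, Complex.ofReal_re,
          Complex.I_im, Complex.I_re, mul_one, mul_zero, zero_add, add_zero, Complex.add_re,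
          Complex.mul_re, sub_zero, Complex.ofReal_zero] at hrect ⊢
    have hv : ∀ t : ℝ, ‖∫ s in ε..δ, F (t + s * Complex.I)‖ ≤ B * |δ - ε| := fun t =>
      intervalIntegral.norm_integral_le_of_norm_le_const fun s hs => hB _ (by
        simpa using (lt_min hε hδ).trans hs.1)
    rw [dist_eq_norm]
    have heq :
        (∫ r in (0 : ℝ)..t, F (r + ε * Complex.I)) - (∫ r in (0 : ℝ)..t, F (r + δ * Complex.I))
        = Complex.I • (∫ s in ε..δ, F ((0 : ℝ) + s * Complex.I))
          - Complex.I • (∫ s in ε..δ, F (t + s * Complex.I)) := by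
      simp only [Complex.ofReal_zero, zero_add]
      linear_combination hrect
    rw [heq]
    refine (norm_sub_le _ _).trans ?_
    rw [norm_smul, norm_smul, Complex.norm_I, one_mul, one_mul]
    have h1 := hv 0
    have h2 := hv t
    linarith
  have hc : ∀ t : ℝ, ∃ a, Tendsto
      (fun k : ℕ => ∫ r in (0 : ℝ)..t, F (bdryPt r (1 / ((k : ℝ) + 1)))) atTop (𝓝 a) := by
    intro t
    refine cauchySeq_tendsto_of_complete (cauchySeq_of_le_tendsto_0
      (fun N : ℕ => 2 * B * (1 / ((N : ℝ) + 1))) (fun k l N hk hl => ?_) ?_)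
    · refine (hdiff t _ _ (by positivity) (by positivity)).trans ?_
      have h1 : (1 : ℝ) / (k + 1) ≤ 1 / (N + 1) := by gcongr
      have h2 : (1 : ℝ) / (l + 1) ≤ 1 / (N + 1) := by gcongr
      have h3 : (0 : ℝ) < 1 / (k + 1) := by positivity
      have h4 : (0 : ℝ) < 1 / (l + 1) := by positivity
      gcongr
      rw [abs_le]
      constructor <;> linarith
    · simpa using tendsto_one_div_add_atTop_nhds_zero_nat.const_mul (2 * B)
  choose Φ hΦ using hc
  have hΦ2 : ∀ s t, Tendsto (fun k : ℕ => ∫ r in s..t, F (bdryPt r (1 / ((k : ℝ) + 1)))) atTop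
        (𝓝 (Φ t - Φ s)) := by
    intro s t
    refine ((hΦ t).sub (hΦ s)).congr fun k => ?_
    have hi := hcont (1 / ((k : ℝ) + 1)) (by positivity)
    exact intervalIntegral.integral_interval_sub_left (hi.intervalIntegrable _ _)
      (hi.intervalIntegrable _ _)
  refine ⟨Φ, fun s t => ?_, hΦ2⟩
  refine le_of_tendsto (hΦ2 s t).norm (Eventually.of_forall fun k => ?_)
  exact intervalIntegral.norm_integral_le_of_norm_le_const fun r _ => hB _ (by
    simp only [bdryPt, Complex.add_im, Complex.ofReal_im, Complex.mul_im, Complex.ofReal_re,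
      Complex.I_im, Complex.I_re, mul_one, mul_zero, zero_add, add_zero]
    positivity)

/-- The integral of the Poisson kernel against the boundary primitive, after an integration by
parts: no boundary values of `F` itself are needed. -/
theorem exists_lipschitz_representation {F : ℂ → ℂ} {B : ℝ}
    (hF : DifferentiableOn ℂ F {w | 0 < w.im}) (hB : ∀ w : ℂ, 0 < w.im → ‖F w‖ ≤ B) :
    ∃ Φ : ℝ → ℂ, (∀ s t, ‖Φ t - Φ s‖ ≤ B * |t - s|) ∧ ∀ x y : ℝ, 0 < y →
      ∫ t : ℝ, ((2 * (t - x) * ((t - x) ^ 2 + y ^ 2)⁻¹ ^ 2 : ℝ) : ℂ) * (Φ t - Φ x)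
        = (Real.pi / y) • F (bdryPt x y) := by
  have hB0 : 0 ≤ B := (norm_nonneg _).trans (hB Complex.I (by simp))
  obtain ⟨Φ, hL, hΦ⟩ := exists_boundary_primitive hF hB
  refine ⟨Φ, hL, fun x y hy => ?_⟩
  set P : ℝ → ℝ := fun t => ((t - x) ^ 2 + y ^ 2)⁻¹ with hP
  have hP0 : ∀ t, 0 < P t := fun t => by positivity
  have hPle : ∀ t, (t - x) ^ 2 * P t ≤ 1 := fun t => by
    simp only [hP]
    rw [← div_eq_mul_inv, div_le_one (by positivity)]
    nlinarith
  have hPd : ∀ t, HasDerivAt (fun t => (P t : ℂ)) (-((2 * (t - x) * P t ^ 2 : ℝ) : ℂ)) t := by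
    intro t
    have h1 : HasDerivAt (fun t : ℝ => (t - x) ^ 2 + y ^ 2) (2 * (t - x)) t := by
      simpa using (((hasDerivAt_id t).sub_const x).pow 2).add_const (y ^ 2)
    have h2 := (h1.inv (by positivity)).ofReal_comp
    refine h2.congr_deriv ?_
    rw [← Complex.ofReal_neg]
    congr 1
    simp only [hP]
    field_simp
  have hint : Integrable P := integrable_inv_sub_sq_add_sq x hy
  have hPcont : Continuous P := by
    refine Continuous.inv₀ (by fun_prop) fun t => ?_
    positivity
  -- the primitives along the line at height `1 / (k + 1)`, normalized to vanish at `x`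
  set Ψ : ℕ → ℝ → ℂ := fun k t => ∫ r in x..t, F (bdryPt r (1 / ((k : ℝ) + 1))) with hΨ
  have hcont : ∀ k : ℕ, Continuous (fun t : ℝ => F (bdryPt t (1 / ((k : ℝ) + 1)))) := by
    intro k
    refine hF.continuousOn.comp_continuous (by unfold bdryPt; fun_prop) fun t => ?_
    have : (0 : ℝ) < 1 / (k + 1) := by positivity
    simp only [bdryPt, mem_ofPred_eq, Complex.add_im, Complex.ofReal_im, Complex.mul_im,
      Complex.ofReal_re, Complex.I_im, Complex.I_re, mul_one, mul_zero, zero_add, add_zero]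
    exact this
  have hFb : ∀ (k : ℕ) (t : ℝ), ‖F (bdryPt t (1 / ((k : ℝ) + 1)))‖ ≤ B := fun k t => hB _ (by
    simp only [bdryPt, Complex.add_im, Complex.ofReal_im, Complex.mul_im, Complex.ofReal_re,
      Complex.I_im, Complex.I_re, mul_one, mul_zero, zero_add, add_zero]
    positivity)
  have hΨd : ∀ k t, HasDerivAt (Ψ k) (F (bdryPt t (1 / ((k : ℝ) + 1)))) t := fun k t =>
    intervalIntegral.integral_hasDerivAt_right ((hcont k).intervalIntegrable _ _)
      ((hcont k).stronglyMeasurableAtFilter _ _) (hcont k).continuousAt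
  have hΨcont : ∀ k, Continuous (Ψ k) := fun k =>
    continuous_iff_continuousAt.mpr fun t => (hΨd k t).continuousAt
  have hΨb : ∀ k t, ‖Ψ k t‖ ≤ B * |t - x| := fun k t =>
    intervalIntegral.norm_integral_le_of_norm_le_const fun r _ => hFb k r
  have hbd : ∀ k t, ‖((2 * (t - x) * P t ^ 2 : ℝ) : ℂ) * Ψ k t‖ ≤ 2 * B * P t := by
    intro k t
    rw [norm_mul, Complex.norm_real, Real.norm_eq_abs, abs_mul, abs_mul, abs_two,
      abs_of_pos (pow_pos (hP0 t) 2)]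
    calc 2 * |t - x| * P t ^ 2 * ‖Ψ k t‖ ≤ 2 * |t - x| * P t ^ 2 * (B * |t - x|) := by
          gcongr
          exact hΨb k t
      _ = 2 * B * P t * ((t - x) ^ 2 * P t) := by rw [← sq_abs (t - x)]; ring
      _ ≤ 2 * B * P t * 1 := by
          have := (hP0 t).le
          gcongr
          exact hPle t
      _ = _ := mul_one _
  have hkcont : Continuous (fun t => ((2 * (t - x) * P t ^ 2 : ℝ) : ℂ)) := by fun_prop
  have hvanish : ∀ (k : ℕ) (l : Filter ℝ), Tendsto (fun t : ℝ => |t - x|) l atTop →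
      Tendsto ((fun t => (P t : ℂ)) * Ψ k) l (𝓝 0) := by
    intro k l hl
    have h0 : Tendsto (fun t : ℝ => B / |t - x|) l (𝓝 0) := tendsto_const_nhds.div_atTop hl
    refine squeeze_zero_norm' ?_ h0
    filter_upwards [hl.eventually_gt_atTop 0] with t ht
    rw [Pi.mul_apply, norm_mul, Complex.norm_real, Real.norm_eq_abs, abs_of_pos (hP0 t)]
    calc P t * ‖Ψ k t‖ ≤ P t * (B * |t - x|) := by
          have := (hP0 t).le
          gcongr
          exact hΨb k t
      _ = B * ((t - x) ^ 2 * P t) / |t - x| := by rw [← sq_abs (t - x)]; field_simp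
      _ ≤ B * 1 / |t - x| := by
          gcongr
          exact hPle t
      _ = _ := by rw [mul_one]
  have hk : ∀ k : ℕ, ∫ t : ℝ, ((2 * (t - x) * P t ^ 2 : ℝ) : ℂ) * Ψ k t
      = (Real.pi / y) • F (bdryPt x y + (1 / ((k : ℝ) + 1) : ℝ) * Complex.I) := by
    intro k
    have hε : (0 : ℝ) < 1 / (k + 1) := by positivity
    have hpf := poisson_formula (G := fun w => F (w + (1 / ((k : ℝ) + 1) : ℝ) * Complex.I))
      (B := B) hε (hF.comp (by fun_prop) fun w hw => by
        simp only [mem_ofPred_eq, Complex.add_im, Complex.ofReal_im, Complex.mul_im,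
          Complex.ofReal_re, Complex.I_im, Complex.I_re, mul_one, mul_zero, add_zero] at hw ⊢
        linarith) (fun w hw => hB _ (by
        simp only [Complex.add_im, Complex.ofReal_im, Complex.mul_im,
          Complex.ofReal_re, Complex.I_im, Complex.I_re, mul_one, mul_zero, add_zero] at hw ⊢
        linarith)) x hy
    rw [← hpf]
    have hparts := integral_mul_deriv_eq_deriv_mul (a' := 0) (b' := 0) (fun t _ => hPd t)
      (fun t _ => hΨd k t)
      (Integrable.congr (hint.smul_bdd B (hcont k).aestronglyMeasurable
        (Eventually.of_forall (hFb k))) (Eventually.of_forall fun t => by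
          simp [Complex.real_smul]))
      (((hint.const_mul (2 * B)).mono' (hkcont.neg.mul (hΨcont k)).aestronglyMeasurable
        (Eventually.of_forall fun t => by
          rw [Pi.mul_apply, neg_mul, norm_neg]
          exact hbd k t)))
      (hvanish k _ (tendsto_abs_atBot_atTop.comp (tendsto_atBot_add_const_right _ (-x) tendsto_id)))
      (hvanish k _ (tendsto_abs_atTop_atTop.comp (tendsto_atTop_add_const_right _ (-x) tendsto_id)))
    simp only [neg_mul, integral_neg, sub_neg_eq_add, sub_zero, zero_add] at hparts
    rw [← hparts]
    rfl
  have hlim1 : Tendsto (fun k : ℕ => ∫ t : ℝ, ((2 * (t - x) * P t ^ 2 : ℝ) : ℂ) * Ψ k t) atTop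
      (𝓝 (∫ t : ℝ, ((2 * (t - x) * P t ^ 2 : ℝ) : ℂ) * (Φ t - Φ x))) :=
    tendsto_integral_of_dominated_convergence (fun t => 2 * B * P t)
      (fun k => (hkcont.mul (hΨcont k)).aestronglyMeasurable) (hint.const_mul _)
      (fun k => Eventually.of_forall (hbd k))
      (Eventually.of_forall fun t => (hΦ x t).const_mul _)
  have hlim2 : Tendsto (fun k : ℕ => (Real.pi / y) •
      F (bdryPt x y + (1 / ((k : ℝ) + 1) : ℝ) * Complex.I)) atTop
      (𝓝 ((Real.pi / y) • F (bdryPt x y))) := by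
    refine Tendsto.const_smul ?_ _
    have hz : 0 < (bdryPt x y).im := by simpa [bdryPt] using hy
    have hca : ContinuousAt F (bdryPt x y) := (hF.differentiableAt
      ((isOpen_lt continuous_const Complex.continuous_im).mem_nhds hz)).continuousAt
    refine hca.tendsto.comp ?_
    have h1 : Tendsto (fun k : ℕ => ((1 / ((k : ℝ) + 1) : ℝ) : ℂ)) atTop (𝓝 ((0 : ℝ) : ℂ)) :=
      (Complex.continuous_ofReal.tendsto 0).comp tendsto_one_div_add_atTop_nhds_zero_nat
    simpa using (h1.mul_const Complex.I).const_add (bdryPt x y)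
  exact tendsto_nhds_unique hlim1 (hlim2.congr fun k => (hk k).symm)

/-- Fatou's theorem: a bounded analytic function on the upper half-plane has vertical limits at
almost every point of the real line, namely at the points where its boundary primitive is
differentiable. -/
theorem ae_exists_tendsto_of_bounded {F : ℂ → ℂ} {B : ℝ}
    (hF : DifferentiableOn ℂ F {w | 0 < w.im}) (hB : ∀ w : ℂ, 0 < w.im → ‖F w‖ ≤ B) :
    ∀ᵐ x : ℝ, ∃ a, Tendsto (fun ε : ℝ => F (bdryPt x ε)) (𝓝[>] 0) (𝓝 a) := by
  have hB0 : 0 ≤ B := (norm_nonneg _).trans (hB Complex.I (by simp))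
  obtain ⟨Φ, hL, hrep⟩ := exists_lipschitz_representation hF hB
  have hlip : LipschitzWith ⟨B, hB0⟩ Φ := LipschitzWith.of_dist_le_mul fun s t => by
    rw [dist_eq_norm, Real.dist_eq]
    exact hL t s
  filter_upwards [hlip.ae_differentiableAt] with x hx
  set a := deriv Φ x
  -- after the substitution `t = x + y s` the representation is an average of difference quotients
  have hsub : ∀ y : ℝ, 0 < y → F (bdryPt x y) = (Real.pi)⁻¹ •
      ∫ s : ℝ, ((2 * s * (1 + s ^ 2)⁻¹ ^ 2 : ℝ) : ℂ) * (y⁻¹ • (Φ (x + y * s) - Φ x)) := by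
    intro y hy
    have h1 := hrep x y hy
    set g : ℝ → ℂ := fun t =>
      ((2 * (t - x) * ((t - x) ^ 2 + y ^ 2)⁻¹ ^ 2 : ℝ) : ℂ) * (Φ t - Φ x) with hg
    have h2 : ∫ s : ℝ, g (x + y * s) = y⁻¹ • ∫ t, g t := by
      rw [Measure.integral_comp_mul_left (fun t => g (x + t)) y, integral_add_left_eq_self,
        abs_of_pos (inv_pos.mpr hy)]
    have h3 : ∀ s : ℝ, ((2 * s * (1 + s ^ 2)⁻¹ ^ 2 : ℝ) : ℂ) * (y⁻¹ • (Φ (x + y * s) - Φ x))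
        = (y ^ 2) • g (x + y * s) := by
      intro s
      simp only [hg, Complex.real_smul, ← mul_assoc, ← Complex.ofReal_mul]
      congr 2
      have : (x + y * s - x) ^ 2 + y ^ 2 = y ^ 2 * (1 + s ^ 2) := by ring
      rw [this]
      field_simp
      ring
    simp_rw [h3]
    rw [integral_smul, h2, h1, smul_smul, smul_smul, smul_smul]
    have : Real.pi⁻¹ * y ^ 2 * y⁻¹ * (Real.pi / y) = 1 := by
      have := Real.pi_ne_zero
      field_simp
    rw [this, one_smul]
  refine ⟨(Real.pi)⁻¹ • ∫ s : ℝ, ((2 * s * (1 + s ^ 2)⁻¹ ^ 2 : ℝ) : ℂ) * (s • a), ?_⟩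
  refine Tendsto.congr' (f₁ := fun y : ℝ => (Real.pi)⁻¹ •
      ∫ s : ℝ, ((2 * s * (1 + s ^ 2)⁻¹ ^ 2 : ℝ) : ℂ) * (y⁻¹ • (Φ (x + y * s) - Φ x))) ?_ ?_
  · filter_upwards [self_mem_nhdsWithin] with y hy
    exact (hsub y hy).symm
  refine Tendsto.const_smul ?_ _
  have hΦc : Continuous Φ := hlip.continuous
  refine tendsto_integral_filter_of_dominated_convergence (fun s => 2 * B * (1 + s ^ 2)⁻¹) ?_ ?_
    (integrable_inv_one_add_sq.const_mul _) ?_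
  · refine Eventually.of_forall fun y => Continuous.aestronglyMeasurable ?_
    have : Continuous fun s : ℝ => (1 + s ^ 2)⁻¹ :=
      Continuous.inv₀ (by fun_prop) fun s => by positivity
    fun_prop
  · filter_upwards [self_mem_nhdsWithin] with y hy
    refine Eventually.of_forall fun s => ?_
    have hy' : 0 < y := hy
    have hP0 : 0 < (1 + s ^ 2)⁻¹ := by positivity
    have hPle : s ^ 2 * (1 + s ^ 2)⁻¹ ≤ 1 := by
      rw [← div_eq_mul_inv, div_le_one (by positivity)]
      linarith
    have hq : ‖y⁻¹ • (Φ (x + y * s) - Φ x)‖ ≤ B * |s| := by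
      rw [norm_smul, Real.norm_eq_abs, abs_of_pos (inv_pos.mpr hy')]
      have := hL x (x + y * s)
      rw [add_sub_cancel_left, abs_mul, abs_of_pos hy'] at this
      rw [inv_mul_le_iff₀ hy']
      linarith
    rw [norm_mul, Complex.norm_real, Real.norm_eq_abs, abs_mul, abs_mul, abs_two,
      abs_of_pos (pow_pos hP0 2)]
    calc 2 * |s| * (1 + s ^ 2)⁻¹ ^ 2 * ‖y⁻¹ • (Φ (x + y * s) - Φ x)‖
        ≤ 2 * |s| * (1 + s ^ 2)⁻¹ ^ 2 * (B * |s|) := by gcongr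
      _ = 2 * B * (1 + s ^ 2)⁻¹ * (s ^ 2 * (1 + s ^ 2)⁻¹) := by rw [← sq_abs s]; ring
      _ ≤ 2 * B * (1 + s ^ 2)⁻¹ * 1 := by gcongr
      _ = _ := mul_one _
  · refine Eventually.of_forall fun s => Tendsto.const_mul _ ?_
    have h1 : HasDerivAt (fun y : ℝ => Φ (x + y * s)) (s • a) 0 := by
      have h2 : HasDerivAt (fun y : ℝ => x + y * s) s 0 := by
        simpa using ((hasDerivAt_id (0 : ℝ)).mul_const s).const_add x
      have h3 : HasDerivAt Φ a (x + 0 * s) := by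
        rw [zero_mul, add_zero]
        exact hx.hasDerivAt
      exact h3.scomp (0 : ℝ) h2
    have h4 := hasDerivAt_iff_tendsto_slope_zero.mp h1
    simp only [zero_add, zero_mul, add_zero] at h4
    exact h4.mono_left (nhdsWithin_mono _ fun y (hy : 0 < y) => hy.ne')

/-! ### Boundary behaviour of Poisson integrals of measures -/

/-- The integral of the Poisson kernel `ε / ((t - x)² + ε²)` (normalized to total mass `π`) with
respect to `μ`, with values in `[0, ∞]`. -/
noncomputable def poissonLIntegral (μ : Measure ℝ) (x ε : ℝ) : ℝ≥0∞ :=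
  ∫⁻ t, ENNReal.ofReal (ε / ((t - x) ^ 2 + ε ^ 2)) ∂μ

theorem measurable_poissonKernel (x ε : ℝ) :
    Measurable (fun t : ℝ => ε / ((t - x) ^ 2 + ε ^ 2)) := by
  fun_prop

theorem poissonLIntegral_volume (x : ℝ) {ε : ℝ} (hε : 0 < ε) :
    poissonLIntegral volume x ε = ENNReal.ofReal Real.pi := by
  have h := (integrable_inv_sub_sq_add_sq x hε).const_mul ε
  simp only [← div_eq_mul_inv] at h
  rw [poissonLIntegral, ← ofReal_integral_eq_lintegral_ofReal h
    (Eventually.of_forall fun t => by positivity)]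
  simp only [div_eq_mul_inv]
  rw [integral_const_mul, integral_inv_sub_sq_add_sq x hε]
  congr 1
  field_simp

/-- A comparison of two measures on the balls around `x` carries over to their Poisson integrals,
as the superlevel sets of the kernel are such balls. -/
theorem setLIntegral_poissonKernel_mono {μ ν : Measure ℝ} {x δ ε : ℝ} (hδ : 0 < δ) (hε : 0 < ε)
    (h : ∀ r, 0 ≤ r → r ≤ δ → μ (Metric.closedBall x r) ≤ ν (Metric.closedBall x r)) :
    ∫⁻ t in Metric.closedBall x δ, ENNReal.ofReal (ε / ((t - x) ^ 2 + ε ^ 2)) ∂μ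
      ≤ ∫⁻ t in Metric.closedBall x δ, ENNReal.ofReal (ε / ((t - x) ^ 2 + ε ^ 2)) ∂ν := by
  have hm := measurable_poissonKernel x ε
  have hnn : ∀ t : ℝ, 0 ≤ ε / ((t - x) ^ 2 + ε ^ 2) := fun t => by positivity
  rw [lintegral_eq_lintegral_meas_le _ (Eventually.of_forall hnn) hm.aemeasurable,
    lintegral_eq_lintegral_meas_le _ (Eventually.of_forall hnn) hm.aemeasurable]
  refine setLIntegral_mono' measurableSet_Ioi fun s hs => ?_
  have hs0 : 0 < s := hs
  have hms : MeasurableSet {t : ℝ | s ≤ ε / ((t - x) ^ 2 + ε ^ 2)} :=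
    measurableSet_le measurable_const hm
  rw [Measure.restrict_apply hms, Measure.restrict_apply hms]
  have hiff : ∀ t : ℝ, s ≤ ε / ((t - x) ^ 2 + ε ^ 2) ↔ (t - x) ^ 2 ≤ ε / s - ε ^ 2 := by
    intro t
    rw [le_div_iff₀ (by positivity), le_sub_iff_add_le, le_div_iff₀ hs0, mul_comm]
  rcases lt_or_ge (ε / s - ε ^ 2) 0 with hneg | hpos
  · have : {t : ℝ | s ≤ ε / ((t - x) ^ 2 + ε ^ 2)} = ∅ := by
      ext t
      simp only [mem_ofPred_eq, hiff, mem_empty_iff_false, iff_false, not_le]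
      exact hneg.trans_le (sq_nonneg _)
    simp [this]
  · have : {t : ℝ | s ≤ ε / ((t - x) ^ 2 + ε ^ 2)} ∩ Metric.closedBall x δ
        = Metric.closedBall x (min (Real.sqrt (ε / s - ε ^ 2)) δ) := by
      ext t
      simp only [mem_inter_iff, mem_ofPred_eq, hiff, Metric.mem_closedBall, Real.dist_eq,
        le_min_iff, Real.le_sqrt (abs_nonneg _) hpos, sq_abs]
    rw [this]
    exact h _ (le_min (Real.sqrt_nonneg _) hδ.le) (min_le_right _ _)

/-- The growth condition of the Nevanlinna representation implies local finiteness. -/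
theorem isLocallyFiniteMeasure_of_integrable {μ : Measure ℝ}
    (hμ : Integrable (fun t : ℝ => (1 + t ^ 2)⁻¹) μ) : IsLocallyFiniteMeasure μ := by
  refine ⟨fun x => ⟨Metric.closedBall x 1, Metric.closedBall_mem_nhds x one_pos, ?_⟩⟩
  refine (measure_mono fun t ht => ?_).trans_lt
    (hμ.measure_ge_lt_top (ε := (1 + (|x| + 1) ^ 2)⁻¹) (by positivity))
  have h1 : |t| ≤ |x| + 1 := by
    rw [Metric.mem_closedBall, Real.dist_eq] at ht
    have := abs_sub_abs_le_abs_sub t x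
    linarith
  have h2 : t ^ 2 ≤ (|x| + 1) ^ 2 := by
    rw [← sq_abs t]
    gcongr
  simp only [mem_ofPred_eq]
  gcongr

/-- The part of the Poisson integral away from the base point vanishes in the limit. -/
theorem tendsto_setLIntegral_poissonKernel_compl {μ : Measure ℝ}
    (hμ : Integrable (fun t : ℝ => (1 + t ^ 2)⁻¹) μ) (x : ℝ) {δ : ℝ} (hδ : 0 < δ) :
    Tendsto (fun ε : ℝ => ∫⁻ t in (Metric.closedBall x δ)ᶜ,
      ENNReal.ofReal (ε / ((t - x) ^ 2 + ε ^ 2)) ∂μ) (𝓝[>] 0) (𝓝 0) := by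
  set c : ℝ := 2 + (1 + 2 * x ^ 2) / δ ^ 2 with hc
  have hc0 : 0 < c := by positivity
  set J := ∫⁻ t, ENNReal.ofReal ((1 + t ^ 2)⁻¹) ∂μ with hJ
  have hJtop : J ≠ ∞ := hμ.lintegral_lt_top.ne
  have hlim : Tendsto (fun ε : ℝ => ENNReal.ofReal (ε * c) * J) (𝓝[>] 0) (𝓝 0) := by
    have h1 : Tendsto (fun ε : ℝ => ENNReal.ofReal (ε * c)) (𝓝[>] 0) (𝓝 0) := by
      have : Continuous fun ε : ℝ => ENNReal.ofReal (ε * c) :=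
        ENNReal.continuous_ofReal.comp (by fun_prop)
      simpa using (this.tendsto 0).mono_left nhdsWithin_le_nhds
    simpa using ENNReal.Tendsto.mul_const h1 (Or.inr hJtop)
  refine tendsto_of_tendsto_of_tendsto_of_le_of_le' tendsto_const_nhds hlim
    (Eventually.of_forall fun _ => zero_le) ?_
  filter_upwards [self_mem_nhdsWithin] with ε hε
  have hε0 : 0 < ε := hε
  rw [hJ, ← lintegral_const_mul _ (by fun_prop)]
  refine (setLIntegral_mono' Metric.isClosed_closedBall.measurableSet.compl fun t ht => ?_).trans
    (setLIntegral_le_lintegral _ _)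
  rw [← ENNReal.ofReal_mul (by positivity)]
  refine ENNReal.ofReal_le_ofReal ?_
  have hd : δ ^ 2 ≤ (t - x) ^ 2 := by
    rw [mem_compl_iff, Metric.mem_closedBall, not_le, Real.dist_eq] at ht
    rw [← sq_abs (t - x)]
    gcongr
  have hp : 0 < (t - x) ^ 2 := (by positivity : 0 < δ ^ 2).trans_le hd
  have h1 : 1 + t ^ 2 ≤ c * (t - x) ^ 2 := by
    have h2 : (1 + 2 * x ^ 2) ≤ (1 + 2 * x ^ 2) / δ ^ 2 * (t - x) ^ 2 := by
      rw [div_mul_eq_mul_div, le_div_iff₀ (by positivity)]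
      gcongr
    have h3 : 0 ≤ (t - 2 * x) ^ 2 := sq_nonneg _
    rw [hc, add_mul]
    nlinarith
  rw [← div_eq_mul_inv, div_le_div_iff₀ (by positivity) (by positivity)]
  calc ε * (1 + t ^ 2) ≤ ε * (c * (t - x) ^ 2) := by gcongr
    _ ≤ ε * c * ((t - x) ^ 2 + ε ^ 2) := by
      rw [mul_assoc]
      gcongr
      exact le_add_of_nonneg_right (sq_nonneg _)

theorem poissonLIntegral_eq_add (μ : Measure ℝ) (x ε δ : ℝ) :
    poissonLIntegral μ x ε
      = (∫⁻ t in Metric.closedBall x δ, ENNReal.ofReal (ε / ((t - x) ^ 2 + ε ^ 2)) ∂μ)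
        + ∫⁻ t in (Metric.closedBall x δ)ᶜ, ENNReal.ofReal (ε / ((t - x) ^ 2 + ε ^ 2)) ∂μ :=
  (lintegral_add_compl _ Metric.isClosed_closedBall.measurableSet).symm

theorem tendsto_setLIntegral_poissonKernel_volume (x : ℝ) {δ : ℝ} (hδ : 0 < δ) :
    Tendsto (fun ε : ℝ => ∫⁻ t in Metric.closedBall x δ,
      ENNReal.ofReal (ε / ((t - x) ^ 2 + ε ^ 2))) (𝓝[>] 0) (𝓝 (ENNReal.ofReal Real.pi)) := by
  have h0 := tendsto_setLIntegral_poissonKernel_compl (μ := volume) integrable_inv_one_add_sq x hδ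
  have h1 : Tendsto (fun ε : ℝ => ENNReal.ofReal Real.pi - ∫⁻ t in (Metric.closedBall x δ)ᶜ,
      ENNReal.ofReal (ε / ((t - x) ^ 2 + ε ^ 2))) (𝓝[>] 0) (𝓝 (ENNReal.ofReal Real.pi - 0)) :=
    ENNReal.Tendsto.sub tendsto_const_nhds h0 (Or.inl ENNReal.ofReal_ne_top)
  rw [tsub_zero] at h1
  refine h1.congr' ?_
  filter_upwards [self_mem_nhdsWithin] with ε hε
  have h2 := poissonLIntegral_eq_add volume x ε δ
  rw [poissonLIntegral_volume x hε] at h2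
  have h3 : ∫⁻ t in (Metric.closedBall x δ)ᶜ, ENNReal.ofReal (ε / ((t - x) ^ 2 + ε ^ 2)) ≠ ∞ := by
    refine ne_top_of_le_ne_top (b := ENNReal.ofReal Real.pi) ENNReal.ofReal_ne_top ?_
    rw [h2]
    exact le_add_self
  rw [h2]
  exact ENNReal.add_sub_cancel_right h3

/-- If the symmetric derivative of `μ` at `x` exists in `[0, ∞]`, then the Poisson integrals at `x`
converge to `π` times it. -/
theorem tendsto_poissonLIntegral {μ : Measure ℝ}
    (hμ : Integrable (fun t : ℝ => (1 + t ^ 2)⁻¹) μ) {x : ℝ} {d : ℝ≥0∞}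
    (hd : Tendsto (fun r => μ (Metric.closedBall x r) / volume (Metric.closedBall x r))
      (𝓝[>] 0) (𝓝 d)) :
    Tendsto (fun ε => poissonLIntegral μ x ε) (𝓝[>] 0) (𝓝 (ENNReal.ofReal Real.pi * d)) := by
  have hπ0 : ENNReal.ofReal Real.pi ≠ 0 := by simp [Real.pi_pos]
  have hπt : ENNReal.ofReal Real.pi ≠ ∞ := ENNReal.ofReal_ne_top
  have hvol0 : ∀ r : ℝ, 0 < r → volume (Metric.closedBall x r) ≠ 0 := fun r hr => by
    simp [Real.volume_closedBall, hr]
  have hvolt : ∀ r : ℝ, volume (Metric.closedBall x r) ≠ ∞ := fun r =>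
    measure_closedBall_lt_top.ne
  have := isLocallyFiniteMeasure_of_integrable hμ
  rw [tendsto_order]
  constructor
  · intro a ha
    obtain ⟨c, hc1, hc2⟩ : ∃ c, a / ENNReal.ofReal Real.pi < c ∧ c < d :=
      exists_between (ENNReal.div_lt_of_lt_mul' ha)
    have hac : a < c * ENNReal.ofReal Real.pi :=
      (ENNReal.div_lt_iff (Or.inl hπ0) (Or.inl hπt)).mp hc1
    obtain ⟨δ, hδ, hδc⟩ := mem_nhdsGT_iff_exists_Ioc_subset.mp (hd.eventually_const_lt hc2)
    have hδ0 : 0 < δ := hδ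
    have hnear := ENNReal.Tendsto.const_mul (a := c)
      (tendsto_setLIntegral_poissonKernel_volume x hδ0) (Or.inr (ne_top_of_lt hc2))
    filter_upwards [hnear.eventually_const_lt hac, self_mem_nhdsWithin] with ε h1 hε
    refine h1.trans_le ?_
    rw [poissonLIntegral_eq_add μ x ε δ, ← smul_eq_mul, ← lintegral_smul_measure,
      ← Measure.restrict_smul]
    refine le_trans (setLIntegral_poissonKernel_mono hδ0 hε fun r hr0 hrδ => ?_) le_self_add
    rcases hr0.eq_or_lt with rfl | hr
    · simp
    · have h2 : c < μ (Metric.closedBall x r) / volume (Metric.closedBall x r) := hδc ⟨hr, hrδ⟩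
      rw [Measure.smul_apply, smul_eq_mul]
      exact (ENNReal.le_div_iff_mul_le (Or.inl (hvol0 r hr)) (Or.inl (hvolt r))).mp h2.le
  · intro b hb
    have hdtop : d ≠ ∞ := by
      rintro rfl
      rw [ENNReal.mul_top hπ0] at hb
      exact not_top_lt hb
    obtain ⟨c, hc1, hc2⟩ : ∃ c, d < c ∧ c < b / ENNReal.ofReal Real.pi := by
      refine exists_between ?_
      rw [ENNReal.lt_div_iff_mul_lt (Or.inl hπ0) (Or.inl hπt), mul_comm]
      exact hb
    have hcb : c * ENNReal.ofReal Real.pi + 0 < b := by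
      rw [add_zero]
      exact (ENNReal.lt_div_iff_mul_lt (Or.inl hπ0) (Or.inl hπt)).mp hc2
    have hct : c ≠ ∞ := ne_top_of_lt hc2
    obtain ⟨δ, hδ, hδc⟩ := mem_nhdsGT_iff_exists_Ioc_subset.mp (hd.eventually_lt_const hc1)
    have hδ0 : 0 < δ := hδ
    have hnear := (ENNReal.Tendsto.const_mul (a := c)
      (tendsto_setLIntegral_poissonKernel_volume x hδ0) (Or.inr hct)).add
      (tendsto_setLIntegral_poissonKernel_compl hμ x hδ0)
    have hball : ∀ r, 0 < r → r ≤ δ →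
        μ (Metric.closedBall x r) ≤ c * volume (Metric.closedBall x r) := by
      intro r hr hrδ
      have h2 : μ (Metric.closedBall x r) / volume (Metric.closedBall x r) < c := hδc ⟨hr, hrδ⟩
      exact (ENNReal.div_le_iff (hvol0 r hr) (hvolt r)).mp h2.le
    -- the bound on the balls of positive radius excludes an atom at `x`
    have hatom : μ {x} = 0 := by
      refine le_antisymm (ge_of_tendsto (x := 𝓝[>] (0 : ℝ))
        (f := fun r => c * volume (Metric.closedBall x r)) ?_ ?_) zero_le
      · have h3 : Tendsto (fun r : ℝ => ENNReal.ofReal (2 * r)) (𝓝[>] 0) (𝓝 0) := by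
          have : Continuous fun r : ℝ => ENNReal.ofReal (2 * r) :=
            ENNReal.continuous_ofReal.comp (by fun_prop)
          simpa using (this.tendsto 0).mono_left nhdsWithin_le_nhds
        simp_rw [Real.volume_closedBall]
        simpa using ENNReal.Tendsto.const_mul (a := c) h3 (Or.inr hct)
      · filter_upwards [Ioc_mem_nhdsGT hδ0] with r hr
        refine le_trans (measure_mono ?_) (hball r hr.1 hr.2)
        simpa using hr.1.le
    filter_upwards [hnear.eventually_lt_const hcb, self_mem_nhdsWithin] with ε h1 hε
    refine lt_of_le_of_lt ?_ h1
    rw [poissonLIntegral_eq_add μ x ε δ]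
    gcongr
    rw [← smul_eq_mul, ← lintegral_smul_measure, ← Measure.restrict_smul]
    refine setLIntegral_poissonKernel_mono hδ0 hε fun r hr0 hrδ => ?_
    rcases hr0.eq_or_lt with rfl | hr
    · simp [hatom]
    · exact hball r hr hrδ

/-- At Lebesgue-almost every point the Poisson integrals converge to `π` times the density of the
absolutely continuous part. -/
theorem ae_tendsto_poissonLIntegral {μ : Measure ℝ}
    (hμ : Integrable (fun t : ℝ => (1 + t ^ 2)⁻¹) μ) :
    ∀ᵐ x : ℝ, Tendsto (fun ε => poissonLIntegral μ x ε) (𝓝[>] 0)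
      (𝓝 (ENNReal.ofReal Real.pi * μ.rnDeriv volume x)) := by
  have := isLocallyFiniteMeasure_of_integrable hμ
  filter_upwards [(Besicovitch.vitaliFamily (volume : Measure ℝ)).ae_tendsto_rnDeriv μ] with x hx
  exact tendsto_poissonLIntegral hμ (hx.comp (Besicovitch.tendsto_filterAt volume x))

/-- On a Lebesgue null set the Poisson integrals tend to `∞` at `μ`-almost every point, because
there the derivative of Lebesgue measure with respect to `μ` is zero. -/
theorem ae_restrict_tendsto_poissonLIntegral_top {μ : Measure ℝ}
    (hμ : Integrable (fun t : ℝ => (1 + t ^ 2)⁻¹) μ) {N : Set ℝ}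
    (hN0 : volume N = 0) :
    ∀ᵐ x ∂(μ.restrict N), Tendsto (fun ε => poissonLIntegral μ x ε) (𝓝[>] 0) (𝓝 ∞) := by
  have := isLocallyFiniteMeasure_of_integrable hμ
  have h0 : ∀ᵐ x ∂(μ.restrict N), (volume : Measure ℝ).rnDeriv μ x = 0 := by
    refine (lintegral_eq_zero_iff (Measure.measurable_rnDeriv _ _)).mp ?_
    exact le_antisymm ((Measure.setLIntegral_rnDeriv_le N).trans hN0.le) zero_le
  filter_upwards [h0, ae_restrict_of_ae
    ((Besicovitch.vitaliFamily μ).ae_tendsto_rnDeriv (volume : Measure ℝ))] with x hx0 hx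
  rw [hx0] at hx
  have h1 := hx.comp (Besicovitch.tendsto_filterAt μ x)
  have h2 : Tendsto (fun r => μ (Metric.closedBall x r) / volume (Metric.closedBall x r))
      (𝓝[>] 0) (𝓝 ∞) := by
    rw [← ENNReal.inv_zero]
    refine Tendsto.congr' ?_ (tendsto_inv_iff.mpr h1)
    filter_upwards [self_mem_nhdsWithin] with r hr
    exact ENNReal.inv_div (Or.inr measure_closedBall_lt_top.ne)
      (Or.inr (by simpa [Real.volume_closedBall] using hr))
  have h3 := tendsto_poissonLIntegral hμ h2
  rwa [ENNReal.mul_top (by simp [Real.pi_pos])] at h3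

/-! ### Borel transforms of scalar measures -/

theorem bdryPt_re (x ε : ℝ) : (bdryPt x ε).re = x := by simp [bdryPt]

theorem bdryPt_im (x ε : ℝ) : (bdryPt x ε).im = ε := by simp [bdryPt]

theorem ofReal_sub_ne_zero {z : ℂ} (hz : 0 < z.im) (t : ℝ) : (t : ℂ) - z ≠ 0 := fun h => by
  have := congrArg Complex.im h
  simp at this
  linarith

theorem one_add_ofReal_sq_ne_zero (t : ℝ) : (1 + (t : ℂ) ^ 2) ≠ 0 := by
  have : (0 : ℝ) < 1 + t ^ 2 := by positivity
  exact_mod_cast this.ne'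

theorem herglotzKernel_eq {z : ℂ} (hz : 0 < z.im) (t : ℝ) :
    herglotzKernel z t = (z + (1 + z ^ 2) / (t - z)) * ((1 + t ^ 2)⁻¹ : ℝ) := by
  have h1 := ofReal_sub_ne_zero hz t
  have h2 := one_add_ofReal_sq_ne_zero t
  rw [herglotzKernel]
  push_cast
  field_simp
  ring

theorem continuous_herglotzKernel {z : ℂ} (hz : 0 < z.im) : Continuous (herglotzKernel z) := by
  unfold herglotzKernel
  exact (Continuous.inv₀ (by fun_prop) (ofReal_sub_ne_zero hz)).sub
    (Continuous.div (by fun_prop) (by fun_prop) one_add_ofReal_sq_ne_zero)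

theorem im_le_norm_ofReal_sub (z : ℂ) (t : ℝ) : z.im ≤ ‖(t : ℂ) - z‖ := by
  have := Complex.abs_im_le_norm ((t : ℂ) - z)
  simp only [Complex.sub_im, Complex.ofReal_im, zero_sub, abs_neg] at this
  exact (le_abs_self _).trans this

theorem norm_herglotzKernel_le {z : ℂ} (hz : 0 < z.im) (t : ℝ) :
    ‖herglotzKernel z t‖ ≤ (‖z‖ + ‖1 + z ^ 2‖ / z.im) * (1 + t ^ 2)⁻¹ := by
  rw [herglotzKernel_eq hz, norm_mul, Complex.norm_real, Real.norm_eq_abs,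
    abs_of_pos (by positivity : (0 : ℝ) < (1 + t ^ 2)⁻¹)]
  gcongr
  refine (norm_add_le _ _).trans ?_
  rw [norm_div]
  gcongr
  exact im_le_norm_ofReal_sub z t

theorem integrable_herglotzKernel {μ : Measure ℝ} (hμ : Integrable (fun t : ℝ => (1 + t ^ 2)⁻¹) μ)
    {z : ℂ} (hz : 0 < z.im) : Integrable (herglotzKernel z) μ :=
  (hμ.const_mul _).mono' (continuous_herglotzKernel hz).aestronglyMeasurable
    (Eventually.of_forall (norm_herglotzKernel_le hz))

theorem herglotzKernel_bdryPt_im (x ε t : ℝ) :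
    (herglotzKernel (bdryPt x ε) t).im = ε / ((t - x) ^ 2 + ε ^ 2) := by
  have h1 : (t : ℂ) / (1 + (t : ℂ) ^ 2) = ((t / (1 + t ^ 2) : ℝ) : ℂ) := by push_cast; rfl
  rw [herglotzKernel, h1, Complex.sub_im, Complex.ofReal_im, sub_zero, Complex.inv_im,
    Complex.normSq_apply]
  simp only [Complex.sub_im, Complex.sub_re, Complex.ofReal_im, Complex.ofReal_re, bdryPt_re,
    bdryPt_im]
  congr 1 <;> ring

/-- The Borel transform `∫ ((λ - z)⁻¹ - λ (1 + λ²)⁻¹) dμ(λ)` of a scalar measure. -/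
noncomputable def borelTransform (μ : Measure ℝ) (z : ℂ) : ℂ := ∫ t, herglotzKernel z t ∂μ

theorem differentiableOn_borelTransform {μ : Measure ℝ}
    (hμ : Integrable (fun t : ℝ => (1 + t ^ 2)⁻¹) μ) :
    DifferentiableOn ℂ (borelTransform μ) {w | 0 < w.im} := by
  intro z hz
  have hz : 0 < z.im := hz
  set A : ℝ := |z.re| + z.im / 2 with hA
  set c : ℝ := 2 + (1 + 2 * A ^ 2) / (z.im / 2) ^ 2 with hc
  have him : ∀ w ∈ Metric.ball z (z.im / 2), z.im / 2 < w.im ∧ |w.re| ≤ A := by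
    intro w hw
    rw [Metric.mem_ball, dist_eq_norm] at hw
    have h1 := (Complex.abs_im_le_norm (w - z)).trans_lt hw
    have h2 := (Complex.abs_re_le_norm (w - z)).trans_lt hw
    rw [Complex.sub_im, abs_lt] at h1
    rw [Complex.sub_re] at h2
    have h3 := abs_sub_abs_le_abs_sub w.re z.re
    exact ⟨by linarith [h1.1], by rw [hA]; linarith⟩
  have hdiff : ∀ (t : ℝ), ∀ w ∈ Metric.ball z (z.im / 2),
      HasDerivAt (fun w => herglotzKernel w t) ((((t : ℂ) - w) ^ 2)⁻¹) w := by
    intro t w hw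
    have hw0 : 0 < w.im := by linarith [(him w hw).1]
    have h1 : HasDerivAt (fun w : ℂ => (t : ℂ) - w) (-1) w := by
      simpa using (hasDerivAt_id w).const_sub (t : ℂ)
    have h2 := (h1.inv (ofReal_sub_ne_zero hw0 t)).sub_const ((t : ℂ) / (1 + (t : ℂ) ^ 2))
    refine h2.congr_deriv ?_
    rw [neg_neg, one_div]
  have hbound : ∀ (t : ℝ), ∀ w ∈ Metric.ball z (z.im / 2),
      ‖(((t : ℂ) - w) ^ 2)⁻¹‖ ≤ c * (1 + t ^ 2)⁻¹ := by
    intro t w hw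
    obtain ⟨hw1, hw2⟩ := him w hw
    have hw0 : 0 < w.im := by linarith
    have hn : ‖(t : ℂ) - w‖ ^ 2 = (t - w.re) ^ 2 + w.im ^ 2 := by
      rw [← Complex.normSq_eq_norm_sq, Complex.normSq_apply]
      simp only [Complex.sub_re, Complex.sub_im, Complex.ofReal_re, Complex.ofReal_im]
      ring
    rw [norm_inv, norm_pow, hn, ← div_eq_mul_inv, inv_eq_one_div,
      div_le_div_iff₀ (by positivity) (by positivity), one_mul]
    have h1 : w.re ^ 2 ≤ A ^ 2 := by rw [← sq_abs w.re]; gcongr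
    have h2 : (z.im / 2) ^ 2 ≤ (t - w.re) ^ 2 + w.im ^ 2 := by
      have : (z.im / 2) ^ 2 ≤ w.im ^ 2 := by gcongr
      nlinarith [sq_nonneg (t - w.re)]
    have h3 : (1 + 2 * A ^ 2) ≤ (1 + 2 * A ^ 2) / (z.im / 2) ^ 2 * ((t - w.re) ^ 2 + w.im ^ 2) := by
      rw [div_mul_eq_mul_div, le_div_iff₀ (by positivity)]
      gcongr
    rw [hc, add_mul]
    nlinarith [sq_nonneg (t - 2 * w.re), sq_nonneg w.im]
  have hcont : Continuous fun t : ℝ => ((((t : ℂ) - z) ^ 2)⁻¹) :=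
    Continuous.inv₀ (by fun_prop) fun t => pow_ne_zero 2 (ofReal_sub_ne_zero hz t)
  have hball : Metric.ball z (z.im / 2) ∈ 𝓝 z := Metric.ball_mem_nhds z (by linarith)
  refine (hasDerivAt_integral_of_dominated_loc_of_deriv_le (μ := μ) hball
    (F := fun w t => herglotzKernel w t) (F' := fun w t => (((t : ℂ) - w) ^ 2)⁻¹)
    (bound := fun t => c * (1 + t ^ 2)⁻¹) ?_
    (integrable_herglotzKernel hμ hz) hcont.aestronglyMeasurable
    (Eventually.of_forall hbound) (hμ.const_mul c)
    (Eventually.of_forall hdiff)).2.differentiableAt.differentiableWithinAt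
  filter_upwards [hball] with w hw
  exact (continuous_herglotzKernel (by linarith [(him w hw).1])).aestronglyMeasurable

theorem ofReal_borelTransform_im {μ : Measure ℝ} (hμ : Integrable (fun t : ℝ => (1 + t ^ 2)⁻¹) μ)
    (x : ℝ) {ε : ℝ} (hε : 0 < ε) :
    ENNReal.ofReal (borelTransform μ (bdryPt x ε)).im = poissonLIntegral μ x ε ∧
      0 ≤ (borelTransform μ (bdryPt x ε)).im := by
  have hi := integrable_herglotzKernel hμ (z := bdryPt x ε) (by rwa [bdryPt_im])
  have h1 : (borelTransform μ (bdryPt x ε)).im = ∫ t, ε / ((t - x) ^ 2 + ε ^ 2) ∂μ := by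
    have := integral_im hi
    simp only [RCLike.im_to_complex, herglotzKernel_bdryPt_im] at this
    exact this.symm
  have h2 : Integrable (fun t : ℝ => ε / ((t - x) ^ 2 + ε ^ 2)) μ := by
    refine hi.im.congr (Eventually.of_forall fun t => ?_)
    exact herglotzKernel_bdryPt_im x ε t
  rw [h1]
  refine ⟨ofReal_integral_eq_lintegral_ofReal h2 (Eventually.of_forall fun t => ?_),
    integral_nonneg fun t => ?_⟩ <;> positivity

theorem borelTransform_im_eq {μ : Measure ℝ} (hμ : Integrable (fun t : ℝ => (1 + t ^ 2)⁻¹) μ)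
    (x : ℝ) {ε : ℝ} (hε : 0 < ε) :
    (borelTransform μ (bdryPt x ε)).im = (poissonLIntegral μ x ε).toReal := by
  obtain ⟨h1, h2⟩ := ofReal_borelTransform_im hμ x hε
  rw [← h1, ENNReal.toReal_ofReal h2]

/-- The boundary value of the imaginary part is almost everywhere `π` times the density. -/
theorem ae_tendsto_borelTransform_im {μ : Measure ℝ}
    (hμ : Integrable (fun t : ℝ => (1 + t ^ 2)⁻¹) μ) :
    ∀ᵐ x : ℝ, Tendsto (fun ε => (borelTransform μ (bdryPt x ε)).im) (𝓝[>] 0)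
      (𝓝 (Real.pi * (μ.rnDeriv volume x).toReal)) := by
  have := isLocallyFiniteMeasure_of_integrable hμ
  filter_upwards [ae_tendsto_poissonLIntegral hμ, Measure.rnDeriv_lt_top μ volume] with x hx hx2
  have h1 := (ENNReal.tendsto_toReal (ENNReal.mul_ne_top ENNReal.ofReal_ne_top hx2.ne)).comp hx
  rw [ENNReal.toReal_mul, ENNReal.toReal_ofReal Real.pi_pos.le] at h1
  refine h1.congr' ?_
  filter_upwards [self_mem_nhdsWithin] with ε hε
  exact (borelTransform_im_eq hμ x hε).symm

theorem ae_restrict_tendsto_borelTransform_im_atTop {μ : Measure ℝ}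
    (hμ : Integrable (fun t : ℝ => (1 + t ^ 2)⁻¹) μ) {N : Set ℝ} (hN0 : volume N = 0) :
    ∀ᵐ x ∂(μ.restrict N),
      Tendsto (fun ε => (borelTransform μ (bdryPt x ε)).im) (𝓝[>] 0) atTop := by
  filter_upwards [ae_restrict_tendsto_poissonLIntegral_top hμ hN0] with x hx
  rw [← ENNReal.tendsto_ofReal_nhds_top]
  refine hx.congr' ?_
  filter_upwards [self_mem_nhdsWithin] with ε hε
  exact (ofReal_borelTransform_im hμ x hε).1.symm

/-- `ε m(x + iε)` picks out the mass of the atom at `x`. -/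
theorem tendsto_mul_borelTransform {μ : Measure ℝ}
    (hμ : Integrable (fun t : ℝ => (1 + t ^ 2)⁻¹) μ) (x : ℝ) :
    Tendsto (fun ε : ℝ => (ε : ℂ) * borelTransform μ (bdryPt x ε)) (𝓝[>] 0)
      (𝓝 (Complex.I * (μ {x}).toReal)) := by
  have h1 : Complex.I * ((μ {x}).toReal : ℂ)
      = ∫ t, ({x} : Set ℝ).indicator (fun _ => Complex.I) t ∂μ := by
    rw [integral_indicator_const _ (measurableSet_singleton x), Complex.real_smul, mul_comm]
    rfl
  rw [h1]
  simp_rw [borelTransform, ← integral_const_mul]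
  set b : ℝ := (|x| + 1) + (1 + (|x| + 1) ^ 2) with hb
  have hnear : ∀ᶠ ε : ℝ in 𝓝[>] 0, 0 < ε ∧ ε ≤ 1 := Ioc_mem_nhdsGT one_pos
  refine tendsto_integral_filter_of_dominated_convergence (fun t => b * (1 + t ^ 2)⁻¹) ?_ ?_
    (hμ.const_mul b) ?_
  · filter_upwards [hnear] with ε hε
    exact ((continuous_herglotzKernel (by rw [bdryPt_im]; exact hε.1)).const_mul
      _).aestronglyMeasurable
  · filter_upwards [hnear] with ε hε
    refine Eventually.of_forall fun t => ?_
    have hz : 0 < (bdryPt x ε).im := by rw [bdryPt_im]; exact hε.1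
    have hzn : ‖bdryPt x ε‖ ≤ |x| + 1 := by
      refine (Complex.norm_le_abs_re_add_abs_im _).trans ?_
      rw [bdryPt_re, bdryPt_im, abs_of_pos hε.1]
      linarith [hε.2]
    have hzn2 : ‖1 + bdryPt x ε ^ 2‖ ≤ 1 + (|x| + 1) ^ 2 := by
      refine (norm_add_le _ _).trans ?_
      rw [norm_one, norm_pow]
      gcongr
    rw [norm_mul, Complex.norm_real, Real.norm_eq_abs, abs_of_pos hε.1]
    calc ε * ‖herglotzKernel (bdryPt x ε) t‖
        ≤ ε * ((‖bdryPt x ε‖ + ‖1 + bdryPt x ε ^ 2‖ / (bdryPt x ε).im) * (1 + t ^ 2)⁻¹) := by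
          have := hε.1.le
          gcongr
          exact norm_herglotzKernel_le hz t
      _ = (ε * ‖bdryPt x ε‖ + ‖1 + bdryPt x ε ^ 2‖) * (1 + t ^ 2)⁻¹ := by
          rw [bdryPt_im]
          have := hε.1.ne'
          field_simp
      _ ≤ (1 * (|x| + 1) + (1 + (|x| + 1) ^ 2)) * (1 + t ^ 2)⁻¹ := by
          gcongr
          exact hε.2
      _ = _ := by rw [one_mul]
  · refine Eventually.of_forall fun t => ?_
    have hε0 : Tendsto (fun ε : ℝ => (ε : ℂ)) (𝓝[>] 0) (𝓝 0) :=
      (Complex.continuous_ofReal.tendsto 0).mono_left nhdsWithin_le_nhds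
    have hsub : Tendsto (fun ε : ℝ => (ε : ℂ) * ((t : ℂ) / (1 + (t : ℂ) ^ 2))) (𝓝[>] 0) (𝓝 0) := by
      simpa using hε0.mul_const ((t : ℂ) / (1 + (t : ℂ) ^ 2))
    by_cases ht : t = x
    · subst ht
      rw [indicator_of_mem (mem_singleton t)]
      have h2 : Tendsto (fun ε : ℝ => Complex.I - (ε : ℂ) * ((t : ℂ) / (1 + (t : ℂ) ^ 2)))
          (𝓝[>] 0) (𝓝 Complex.I) := by
        simpa using hsub.const_sub Complex.I
      refine h2.congr' ?_
      filter_upwards [hnear] with ε hε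
      have hεc : (ε : ℂ) ≠ 0 := by exact_mod_cast hε.1.ne'
      rw [herglotzKernel, mul_sub]
      congr 1
      rw [bdryPt, sub_add_cancel_left, inv_neg, mul_inv, Complex.inv_I]
      field_simp
    · rw [indicator_of_notMem (by simpa using ht)]
      have htx : (t : ℂ) - x ≠ 0 := by
        rw [← Complex.ofReal_sub]
        exact_mod_cast sub_ne_zero.mpr ht
      have h2 : Tendsto (fun ε : ℝ => (t : ℂ) - bdryPt x ε) (𝓝[>] 0) (𝓝 ((t : ℂ) - x)) := by
        have : Continuous fun ε : ℝ => (t : ℂ) - bdryPt x ε := by unfold bdryPt; fun_prop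
        have h3 := (this.tendsto 0).mono_left (nhdsWithin_le_nhds (s := Ioi 0))
        simpa [bdryPt] using h3
      have h3 := (hε0.mul (h2.inv₀ htx)).sub hsub
      simp only [zero_mul, sub_zero] at h3
      refine h3.congr fun ε => ?_
      rw [herglotzKernel, mul_sub]

/-- A continuous path whose exponential converges to a nonzero limit converges: near the end of the
path, it differs from a branch of the logarithm by a continuous function with values in `2πiℤ`. -/
theorem exists_tendsto_of_tendsto_exp {f : ℝ → ℂ} (hf : ContinuousOn f (Ioi 0)) {G : ℂ}
    (hG : G ≠ 0) (h : Tendsto (fun ε => Complex.exp (f ε)) (𝓝[>] 0) (𝓝 G)) :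
    ∃ a, Tendsto f (𝓝[>] 0) (𝓝 a) := by
  set g : ℝ → ℂ := fun ε => Complex.exp (f ε) / G with hg
  have hg1 : Tendsto g (𝓝[>] 0) (𝓝 1) := by
    have := h.div_const G
    rwa [div_self hG] at this
  have hslit : ∀ᶠ ε in 𝓝[>] 0, g ε ∈ Complex.slitPlane :=
    hg1.eventually (Complex.isOpen_slitPlane.mem_nhds Complex.one_mem_slitPlane)
  obtain ⟨δ, hδ, hδs⟩ := mem_nhdsGT_iff_exists_Ioo_subset.mp hslit
  have hδ0 : 0 < δ := hδ
  set k : ℝ → ℂ := fun ε => f ε - Complex.log (g ε) with hk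
  have hfc : ContinuousOn f (Ioo 0 δ) := hf.mono fun ε hε => hε.1
  have hkc : ContinuousOn k (Ioo 0 δ) :=
    hfc.sub (ContinuousOn.clog (hfc.cexp.div_const G) fun ε hε => hδs hε)
  have hkG : ∀ ε ∈ Ioo 0 δ, Complex.exp (k ε) = G := by
    intro ε hε
    have hg0 : g ε ≠ 0 := div_ne_zero (Complex.exp_ne_zero _) hG
    rw [hk, Complex.exp_sub, Complex.exp_log hg0]
    simp only [hg]
    have := Complex.exp_ne_zero (f ε)
    field_simp
  have hcount : {w : ℂ | Complex.exp w = G}.Countable := by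
    refine (countable_range fun n : ℤ => Complex.log G + n * (2 * Real.pi * Complex.I)).mono ?_
    intro w hw
    have : Complex.exp w = Complex.exp (Complex.log G) := by
      rw [Complex.exp_log hG]; exact hw
    obtain ⟨n, hn⟩ := Complex.exp_eq_exp_iff_exists_int.mp this
    exact ⟨n, hn.symm⟩
  have hsub : (k '' Ioo 0 δ).Subsingleton :=
    hcount.isTotallyDisconnected _ (image_subset_iff.mpr hkG)
      (isPreconnected_Ioo.image _ hkc)
  have hmid : δ / 2 ∈ Ioo 0 δ := ⟨by linarith, by linarith⟩
  refine ⟨k (δ / 2) + Complex.log 1, ?_⟩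
  have hlog : Tendsto (fun ε => k (δ / 2) + Complex.log (g ε)) (𝓝[>] 0)
      (𝓝 (k (δ / 2) + Complex.log 1)) :=
    (hg1.clog Complex.one_mem_slitPlane).const_add _
  refine hlog.congr' ?_
  filter_upwards [Ioo_mem_nhdsGT hδ0] with ε hε
  rw [hsub (mem_image_of_mem k hmid) (mem_image_of_mem k hε)]
  simp [hk]

/-- The boundary values of a Borel transform `m` exist almost everywhere: `exp (i m)` is bounded and
has boundary values by Fatou's theorem, and these do not vanish where `Im m` has a finite limit. -/
theorem ae_exists_tendsto_borelTransform {μ : Measure ℝ}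
    (hμ : Integrable (fun t : ℝ => (1 + t ^ 2)⁻¹) μ) :
    ∀ᵐ x : ℝ, ∃ a, Tendsto (fun ε => borelTransform μ (bdryPt x ε)) (𝓝[>] 0) (𝓝 a) := by
  have hd := differentiableOn_borelTransform hμ
  have hF : DifferentiableOn ℂ (fun z => Complex.exp (Complex.I * borelTransform μ z))
      {w | 0 < w.im} := (hd.const_mul Complex.I).cexp
  have hB : ∀ w : ℂ, 0 < w.im → ‖Complex.exp (Complex.I * borelTransform μ w)‖ ≤ 1 := by
    intro w hw
    have hwb : w = bdryPt w.re w.im := (Complex.re_add_im w).symm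
    have := (ofReal_borelTransform_im hμ w.re hw).2
    rw [← hwb] at this
    rw [Complex.norm_exp, Real.exp_le_one_iff]
    simpa using this
  filter_upwards [ae_exists_tendsto_of_bounded hF hB, ae_tendsto_borelTransform_im hμ]
    with x ⟨G, hG⟩ him
  have hnorm : Tendsto (fun ε => ‖Complex.exp (Complex.I * borelTransform μ (bdryPt x ε))‖) (𝓝[>] 0)
      (𝓝 (Real.exp (-(Real.pi * (μ.rnDeriv volume x).toReal)))) := by
    simp_rw [Complex.norm_exp, Complex.I_mul_re]
    exact (Real.continuous_exp.tendsto _).comp him.neg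
  have hG0 : G ≠ 0 := by
    rw [← norm_ne_zero_iff, tendsto_nhds_unique hG.norm hnorm]
    exact (Real.exp_pos _).ne'
  have hc : ContinuousOn (fun ε : ℝ => Complex.I * borelTransform μ (bdryPt x ε)) (Ioi 0) := by
    refine (hd.const_mul Complex.I).continuousOn.comp (t := {w : ℂ | 0 < w.im})
      (f := fun ε => bdryPt x ε) ?_ fun ε hε => ?_
    · unfold bdryPt
      fun_prop
    · rw [mem_ofPred_eq, bdryPt_im]
      exact hε
  obtain ⟨a, ha⟩ := exists_tendsto_of_tendsto_exp hc hG0 hG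
  refine ⟨-Complex.I * a, (ha.const_mul (-Complex.I)).congr fun ε => ?_⟩
  rw [← mul_assoc, neg_mul, Complex.I_mul_I, neg_neg, one_mul]

/-! ### Boundary values for bounded densities -/

theorem integrable_mul_herglotzKernel {f : ℝ → ℂ} (hf : AEStronglyMeasurable f volume) {c : ℝ}
    (hc : ∀ᵐ t, ‖f t‖ ≤ c) {z : ℂ} (hz : 0 < z.im) :
    Integrable (fun t => f t * herglotzKernel z t) :=
  (integrable_herglotzKernel integrable_inv_one_add_sq hz).bdd_mul hf hc

/-- The positive part of a bounded real function is the density of a measure, whose Borel transform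
has the boundary values in question. -/
theorem ae_exists_tendsto_integral_posPart {f : ℝ → ℝ} (hf : AEMeasurable f) {c : ℝ}
    (hc : ∀ᵐ t, |f t| ≤ c) :
    ∀ᵐ x : ℝ, ∃ a : ℂ, Tendsto (fun ε : ℝ => ∫ t : ℝ, ((max (f t) 0 : ℝ) : ℂ) *
      herglotzKernel (bdryPt x ε) t) (𝓝[>] 0) (𝓝 a) ∧ a.im = Real.pi * max (f x) 0 := by
  have hd : AEMeasurable (fun t => ENNReal.ofReal (f t)) := hf.ennreal_ofReal
  have htop : ∀ᵐ t : ℝ, ENNReal.ofReal (f t) < ∞ :=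
    Eventually.of_forall fun t => ENNReal.ofReal_lt_top
  set μ : Measure ℝ := volume.withDensity (fun t => ENNReal.ofReal (f t)) with hμdef
  have hμ : Integrable (fun t : ℝ => (1 + t ^ 2)⁻¹) μ := by
    rw [hμdef, integrable_withDensity_iff_integrable_smul₀' hd htop]
    simp_rw [smul_eq_mul]
    refine (integrable_inv_one_add_sq).bdd_mul (c := c)
      hd.ennreal_toReal.aestronglyMeasurable ?_
    filter_upwards [hc] with t ht
    rw [ENNReal.toReal_ofReal', Real.norm_eq_abs, abs_of_nonneg (le_max_right _ _)]
    exact max_le ((le_abs_self _).trans ht) ((abs_nonneg _).trans ht)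
  have hB : ∀ z, borelTransform μ z = ∫ t : ℝ, ((max (f t) 0 : ℝ) : ℂ) * herglotzKernel z t := by
    intro z
    rw [borelTransform, hμdef, integral_withDensity_eq_integral_toReal_smul₀ hd htop]
    simp_rw [ENNReal.toReal_ofReal', Complex.real_smul]
  filter_upwards [ae_exists_tendsto_borelTransform hμ, ae_tendsto_borelTransform_im hμ,
    Measure.rnDeriv_withDensity₀ volume hd] with x ⟨a, ha⟩ him hx
  refine ⟨a, by simpa only [hB] using ha, ?_⟩
  rw [hμdef, hx, ENNReal.toReal_ofReal'] at him
  exact tendsto_nhds_unique ((Complex.continuous_im.tendsto a).comp ha) him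

theorem ae_exists_tendsto_integral_real {f : ℝ → ℝ} (hf : AEMeasurable f) {c : ℝ}
    (hc : ∀ᵐ t, |f t| ≤ c) :
    ∀ᵐ x : ℝ, ∃ a : ℂ, Tendsto (fun ε : ℝ => ∫ t : ℝ, (f t : ℂ) *
      herglotzKernel (bdryPt x ε) t) (𝓝[>] 0) (𝓝 a) ∧ a.im = Real.pi * f x := by
  have hmax : ∀ r : ℝ, max r 0 - max (-r) 0 = r := fun r => by
    rcases le_total r 0 with h | h
    · rw [max_eq_right h, max_eq_left (by linarith)]; ring
    · rw [max_eq_left h, max_eq_right (by linarith)]; ring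
  have hint : ∀ g : ℝ → ℝ, AEMeasurable g → (∀ᵐ t, |g t| ≤ c) → ∀ z : ℂ, 0 < z.im →
      Integrable (fun t : ℝ => ((max (g t) 0 : ℝ) : ℂ) * herglotzKernel z t) := by
    intro g hg hgc z hz
    refine integrable_mul_herglotzKernel (c := c)
      (Complex.measurable_ofReal.comp_aemeasurable
        (hg.max aemeasurable_const)).aestronglyMeasurable ?_ hz
    filter_upwards [hgc] with t ht
    rw [Function.comp_apply, Complex.norm_real, Real.norm_eq_abs, abs_of_nonneg (le_max_right _ _)]
    exact max_le ((le_abs_self _).trans ht) ((abs_nonneg _).trans ht)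
  have hc' : ∀ᵐ t, |-f t| ≤ c := by simpa only [abs_neg] using hc
  filter_upwards [ae_exists_tendsto_integral_posPart hf hc,
    ae_exists_tendsto_integral_posPart hf.neg hc'] with x ⟨a, ha, ha'⟩ ⟨b, hb, hb'⟩
  refine ⟨a - b, (ha.sub hb).congr' ?_, ?_⟩
  · filter_upwards [self_mem_nhdsWithin] with ε hε
    have hz : 0 < (bdryPt x ε).im := by rw [bdryPt_im]; exact hε
    rw [← integral_sub (hint f hf hc _ hz) (hint _ hf.neg hc' _ hz)]
    refine integral_congr_ae (Eventually.of_forall fun t => ?_)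
    simp only [Pi.neg_apply]
    rw [← sub_mul, ← Complex.ofReal_sub, hmax]
  · rw [Complex.sub_im, ha', hb', Pi.neg_apply, ← mul_sub, hmax]

/-- For a bounded complex density `f`, the transforms of `f` against the kernel and against its
conjugate have boundary values almost everywhere, and these differ by `2πi f`. -/
theorem ae_exists_tendsto_integral_complex {f : ℝ → ℂ} (hf : AEStronglyMeasurable f volume) {c : ℝ}
    (hc : ∀ᵐ t, ‖f t‖ ≤ c) :
    ∀ᵐ x : ℝ, ∃ a b : ℂ,
      Tendsto (fun ε : ℝ => ∫ t : ℝ, f t * herglotzKernel (bdryPt x ε) t) (𝓝[>] 0) (𝓝 a) ∧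
      Tendsto (fun ε : ℝ => ∫ t : ℝ, f t * (starRingEnd ℂ) (herglotzKernel (bdryPt x ε) t))
        (𝓝[>] 0) (𝓝 b) ∧ a - b = 2 * Real.pi * Complex.I * f x := by
  have hre : AEMeasurable (fun t => (f t).re) :=
    Complex.measurable_re.comp_aemeasurable hf.aemeasurable
  have him : AEMeasurable (fun t => (f t).im) :=
    Complex.measurable_im.comp_aemeasurable hf.aemeasurable
  have hrec : ∀ᵐ t, |(f t).re| ≤ c := hc.mono fun t ht => (Complex.abs_re_le_norm _).trans ht
  have himc : ∀ᵐ t, |(f t).im| ≤ c := hc.mono fun t ht => (Complex.abs_im_le_norm _).trans ht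
  have hint : ∀ g : ℝ → ℝ, AEMeasurable g → (∀ᵐ t, |g t| ≤ c) → ∀ z : ℂ, 0 < z.im →
      Integrable (fun t : ℝ => (g t : ℂ) * herglotzKernel z t) := by
    intro g hg hgc z hz
    refine integrable_mul_herglotzKernel (c := c)
      (Complex.measurable_ofReal.comp_aemeasurable hg).aestronglyMeasurable ?_ hz
    simpa only [Function.comp_apply, Complex.norm_real, Real.norm_eq_abs] using hgc
  filter_upwards [ae_exists_tendsto_integral_real hre hrec,
    ae_exists_tendsto_integral_real him himc] with x ⟨a, ha, ha'⟩ ⟨b, hb, hb'⟩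
  refine ⟨a + b * Complex.I, (starRingEnd ℂ) a + (starRingEnd ℂ) b * Complex.I,
    (ha.add (hb.mul_const Complex.I)).congr' ?_,
    (((Complex.continuous_conj.tendsto a).comp ha).add
      (((Complex.continuous_conj.tendsto b).comp hb).mul_const Complex.I)).congr' ?_, ?_⟩
  · filter_upwards [self_mem_nhdsWithin] with ε hε
    have hz : 0 < (bdryPt x ε).im := by rw [bdryPt_im]; exact hε
    rw [← integral_mul_const,
      ← integral_add (hint _ hre hrec _ hz) ((hint _ him himc _ hz).mul_const _)]
    refine integral_congr_ae (Eventually.of_forall fun t => ?_)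
    simp only
    nth_rewrite 3 [← Complex.re_add_im (f t)]
    ring
  · filter_upwards [self_mem_nhdsWithin] with ε hε
    have hz : 0 < (bdryPt x ε).im := by rw [bdryPt_im]; exact hε
    simp only [Function.comp_apply]
    have hconj : ∀ g : ℝ → ℝ, (∀ t, (starRingEnd ℂ) ((g t : ℂ) * herglotzKernel (bdryPt x ε) t)
        = (g t : ℂ) * (starRingEnd ℂ) (herglotzKernel (bdryPt x ε) t)) := fun g t => by
      rw [map_mul, Complex.conj_ofReal]
    have hintc : ∀ g : ℝ → ℝ, AEMeasurable g → (∀ᵐ t, |g t| ≤ c) →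
        Integrable (fun t : ℝ => (g t : ℂ) * (starRingEnd ℂ) (herglotzKernel (bdryPt x ε) t)) := by
      intro g hg hgc
      exact ((Complex.conjCLE : ℂ →L[ℝ] ℂ).integrable_comp (hint g hg hgc _ hz)).congr
        (Eventually.of_forall (hconj g))
    rw [← integral_conj, ← integral_conj]
    simp only [map_mul, Complex.conj_ofReal]
    rw [← integral_mul_const, ← integral_add (hintc _ hre hrec) ((hintc _ him himc).mul_const _)]
    refine integral_congr_ae (Eventually.of_forall fun t => ?_)
    simp only
    nth_rewrite 3 [← Complex.re_add_im (f t)]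
    ring
  · have h1 := Complex.sub_conj a
    have h2 := Complex.sub_conj b
    rw [ha'] at h1
    rw [hb'] at h2
    rw [← Complex.re_add_im (f x)]
    push_cast at h1 h2
    linear_combination h1 + Complex.I * h2

/-! ### The trace measure controls null sets and supports -/

namespace MatrixMeasure

variable {n : ℕ}

theorem quad_restrict (Ω : MatrixMeasure n) (x : Fin n → ℂ) {A : Set ℝ} (hA : MeasurableSet A) :
    (Ω.restrict A hA).quad x = (Ω.quad x).restrict A := by
  ext X hX
  rw [Measure.restrict_apply hX, quad, quad, Measure.ofMeasurable_apply _ hX,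
    Measure.ofMeasurable_apply _ (hX.inter hA)]
  refine tsum_congr fun k => ?_
  rw [inter_right_comm]
  rfl

theorem trace_restrict (Ω : MatrixMeasure n) {A : Set ℝ} (hA : MeasurableSet A) :
    (Ω.restrict A hA).trace = Ω.trace.restrict A := by
  ext X hX
  simp [trace, quad_restrict, Measure.finsetSum_apply, Measure.restrict_apply hX]

theorem quadForm_smul (c : ℂ) (x : Fin n → ℂ) (A : Matrix (Fin n) (Fin n) ℂ) :
    quadForm (c • x) A = ‖c‖ ^ 2 * quadForm x A := by
  have h : star (c • x) ⬝ᵥ (A *ᵥ (c • x)) = ((‖c‖ ^ 2 : ℝ) : ℂ) * (star x ⬝ᵥ (A *ᵥ x)) := by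
    rw [star_smul, Matrix.mulVec_smul, smul_dotProduct, dotProduct_smul, smul_smul, smul_eq_mul,
      Complex.star_def, ← Complex.normSq_eq_conj_mul_self, Complex.normSq_eq_norm_sq]
  rw [quadForm, h, Complex.re_ofReal_mul]
  rfl

theorem quad_smul (Ω : MatrixMeasure n) (c : ℂ) (x : Fin n → ℂ) :
    Ω.quad (c • x) = ENNReal.ofReal (‖c‖ ^ 2) • Ω.quad x := by
  ext X hX
  rw [Measure.smul_apply, quad, quad, Measure.ofMeasurable_apply _ hX,
    Measure.ofMeasurable_apply _ hX, smul_eq_mul, ← ENNReal.tsum_mul_left]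
  refine tsum_congr fun k => ?_
  rw [quadForm_smul, ENNReal.ofReal_mul (by positivity)]

theorem measure_eq_zero_of_cells {μ : Measure ℝ} {B : Set ℝ} (h : ∀ k, μ (B ∩ cell k) = 0) :
    μ B = 0 := by
  have hU : (⋃ k : ℤ, B ∩ cell k) = B := by
    have : (⋃ k : ℤ, cell k) = univ := iUnion_Ico_intCast ℝ
    rw [← inter_iUnion, this, inter_univ]
  rw [← hU]
  exact measure_iUnion_null h

theorem isNull_iff (Ω : MatrixMeasure n) {A : Set ℝ} : Ω.IsNull A ↔ Ω.trace A = 0 := by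
  constructor
  · rintro ⟨B, hB, hAB, h⟩
    refine measure_mono_null hAB (measure_eq_zero_of_cells fun k => ?_)
    have hb : Bornology.IsBounded (B ∩ cell k) := (isBounded_cell k).subset inter_subset_right
    have hm := hB.inter (measurableSet_cell k)
    exact (Ω.trace_eq_zero_iff hm hb).mpr (h _ hm hb inter_subset_left)
  · intro h
    refine ⟨toMeasurable Ω.trace A, measurableSet_toMeasurable _ _, subset_toMeasurable _ _,
      fun X hX hb hXB => ?_⟩
    rw [← Ω.trace_eq_zero_iff hX hb]
    exact measure_mono_null hXB (by rw [measure_toMeasurable, h])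

theorem isSupport_iff (Ω : MatrixMeasure n) {S : Set ℝ} : Ω.IsSupport S ↔ Ω.trace Sᶜ = 0 :=
  Ω.isNull_iff

theorem mem_atoms_iff (Ω : MatrixMeasure n) {t : ℝ} : t ∈ Ω.atoms ↔ Ω.trace {t} ≠ 0 :=
  (Ω.trace_eq_zero_iff (measurableSet_singleton t) Bornology.isBounded_singleton).not.symm

/-- As the carrier of the singular part is a Lebesgue null set, the absolutely continuous part is
given by the density of the whole trace measure. -/
theorem trace_acPart (Ω : MatrixMeasure n) :
    Ω.acPart.trace = volume.withDensity (Ω.trace.rnDeriv volume) := by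
  have hN := Ω.measurableSet_singularCarrier
  have hac : Ω.acPart.trace ≪ volume := by
    refine Measure.AbsolutelyContinuous.mk fun X hX h0 => measure_eq_zero_of_cells fun k => ?_
    have hm := hX.inter (measurableSet_cell k)
    have hb : Bornology.IsBounded (X ∩ cell k) := (isBounded_cell k).subset inter_subset_right
    rw [trace_eq_zero_iff _ hm hb]
    exact Ω.apply_diff_singularCarrier hm hb (measure_mono_null inter_subset_left h0)
  rw [← Measure.withDensity_rnDeriv_eq _ _ hac]
  refine withDensity_congr_ae ?_
  rw [acPart, trace_restrict]
  filter_upwards [Measure.rnDeriv_restrict Ω.trace volume hN.compl,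
    measure_eq_zero_iff_ae_notMem.mp Ω.volume_singularCarrier] with x hx hxN
  rw [hx, indicator_of_mem (by simpa using hxN)]

theorem trace_acPart_eq_zero_iff (Ω : MatrixMeasure n) {A : Set ℝ} :
    Ω.acPart.trace A = 0 ↔ ∀ᵐ x : ℝ, x ∈ A → Ω.trace.rnDeriv volume x = 0 := by
  rw [trace_acPart, withDensity_apply_eq_zero' (Measure.measurable_rnDeriv _ _).aemeasurable,
    measure_eq_zero_iff_ae_notMem]
  refine eventually_congr (Eventually.of_forall fun x => ?_)
  simp only [mem_inter_iff, mem_ofPred_eq]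
  tauto

/-- A set that agrees, up to a Lebesgue null set, with the set where the density of the trace
measure does not vanish is a minimal support of the absolutely continuous part. -/
theorem isMinimalSupport_acPart (Ω : MatrixMeasure n) {S : Set ℝ}
    (h : ∀ᵐ x : ℝ, x ∈ S ↔ Ω.trace.rnDeriv volume x ≠ 0) : Ω.acPart.IsMinimalSupport S := by
  refine ⟨?_, fun T _ hT => ?_⟩
  · rw [isSupport_iff, trace_acPart_eq_zero_iff]
    filter_upwards [h] with x hx hxS
    by_contra h0
    exact hxS (hx.mpr h0)
  · rw [isSupport_iff, trace_acPart_eq_zero_iff] at hT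
    rw [measure_eq_zero_iff_ae_notMem]
    filter_upwards [h, hT] with x hx hxT hxST
    exact hx.mp hxST.1 (hxT hxST.2)

theorem trace_eq_add (Ω : MatrixMeasure n) :
    Ω.trace = Ω.trace.restrict Ω.singularCarrier + Ω.acPart.trace := by
  rw [acPart, trace_restrict, Measure.restrict_add_restrict_compl Ω.measurableSet_singularCarrier]

end MatrixMeasure

/-! ### Ranks, Hermitian and nonnegative matrices -/

section Matrices

variable {n : ℕ}

theorem rank_eq_zero_iff_eq_zero (A : Matrix (Fin n) (Fin n) ℂ) : A.rank = 0 ↔ A = 0 := by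
  constructor
  · intro h
    rw [Matrix.rank, Submodule.finrank_eq_zero, LinearMap.range_eq_bot] at h
    have : Matrix.toLin' A = 0 := h
    simpa using this
  · rintro rfl
    exact Matrix.rank_zero

theorem mem_iUnion_rank_iff {p : Matrix (Fin n) (Fin n) ℂ → Prop}
    {f : Matrix (Fin n) (Fin n) ℂ → Matrix (Fin n) (Fin n) ℂ} :
    (∃ r ∈ Icc 1 n, ∃ A, p A ∧ (f A).rank = r) ↔ ∃ A, p A ∧ f A ≠ 0 := by
  constructor
  · rintro ⟨r, hr, A, hA, rfl⟩
    refine ⟨A, hA, fun h => ?_⟩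
    have := hr.1
    rw [h, Matrix.rank_zero] at this
    omega
  · rintro ⟨A, hA, h⟩
    refine ⟨_, ⟨?_, Matrix.rank_le_width _⟩, A, hA, rfl⟩
    exact Nat.one_le_iff_ne_zero.mpr ((rank_eq_zero_iff_eq_zero _).not.mpr h)

theorem mem_suppAC_iff {M : ℂ → Matrix (Fin n) (Fin n) ℂ} {t : ℝ} : t ∈ suppAC M ↔
    ∃ A, Tendsto (fun ε : ℝ => M (bdryPt t ε)) (𝓝[>] 0) (𝓝 A) ∧ matIm A ≠ 0 := by
  rw [← mem_iUnion_rank_iff]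
  simp only [suppAC, suppACRank, mem_iUnion, exists_prop, mem_ofPred_eq]

theorem mem_suppPP_iff {M : ℂ → Matrix (Fin n) (Fin n) ℂ} {t : ℝ} : t ∈ suppPP M ↔
    ∃ A, Tendsto (fun ε : ℝ => (ε : ℂ) • M (bdryPt t ε)) (𝓝[>] 0) (𝓝 A) ∧ A ≠ 0 := by
  refine Iff.trans ?_ (mem_iUnion_rank_iff (f := id))
  simp only [suppPP, suppPPRank, mem_iUnion, exists_prop, mem_ofPred_eq, id]

theorem isHermitian_matRe (A : Matrix (Fin n) (Fin n) ℂ) : (matRe A).IsHermitian := by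
  rw [Matrix.IsHermitian, matRe, Matrix.conjTranspose_smul, Matrix.conjTranspose_add,
    Matrix.conjTranspose_conjTranspose, add_comm]
  simp

theorem matIm_eq_zero_iff {A : Matrix (Fin n) (Fin n) ℂ} : matIm A = 0 ↔ A.IsHermitian := by
  rw [matIm, smul_eq_zero, or_iff_right (by simp), sub_eq_zero, Matrix.IsHermitian, eq_comm]

theorem continuous_matIm : Continuous (matIm : Matrix (Fin n) (Fin n) ℂ → _) := by
  unfold matIm
  fun_prop

theorem trace_matIm (A : Matrix (Fin n) (Fin n) ℂ) : (matIm A).trace = (A.trace.im : ℂ) := by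
  rw [matIm, Matrix.trace_smul, Matrix.trace_sub, Matrix.trace_conjTranspose, Complex.star_def,
    Complex.sub_conj, smul_eq_mul]
  push_cast
  have := Complex.I_ne_zero
  field_simp

theorem posSemidef_of_tendsto {l : Filter ℝ} [l.NeBot] {f : ℝ → Matrix (Fin n) (Fin n) ℂ}
    {A : Matrix (Fin n) (Fin n) ℂ} (h : Tendsto f l (𝓝 A)) (hf : ∀ᶠ ε in l, (f ε).PosSemidef) :
    A.PosSemidef := by
  rw [Matrix.posSemidef_iff_dotProduct_mulVec]
  constructor
  · have h1 : Tendsto (fun ε => (f ε)ᴴ) l (𝓝 Aᴴ) :=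
      (Continuous.tendsto (by fun_prop : Continuous
        fun B : Matrix (Fin n) (Fin n) ℂ => Bᴴ) A).comp h
    refine tendsto_nhds_unique (h1.congr' ?_) h
    filter_upwards [hf] with ε hε
    exact hε.isHermitian
  · intro x
    have h1 : Tendsto (fun ε => star x ⬝ᵥ (f ε *ᵥ x)) l (𝓝 (star x ⬝ᵥ (A *ᵥ x))) :=
      (Continuous.tendsto (by fun_prop : Continuous
        fun B : Matrix (Fin n) (Fin n) ℂ => star x ⬝ᵥ (B *ᵥ x)) A).comp h
    refine ge_of_tendsto h1 ?_
    filter_upwards [hf] with ε hε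
    exact hε.dotProduct_mulVec_nonneg x

/-- The `2 × 2` minors of a nonnegative matrix are nonnegative, which bounds the entries. -/
theorem norm_entry_le_one {A : Matrix (Fin n) (Fin n) ℂ} (h0 : A.PosSemidef)
    (h1 : (1 - A).PosSemidef) (j k : Fin n) : ‖A j k‖ ≤ 1 := by
  have hdiag : ∀ i, 0 ≤ (A i i).re ∧ (A i i).re ≤ 1 ∧ (A i i).im = 0 := by
    intro i
    have ha := Complex.le_def.mp (h0.diag_nonneg (i := i))
    have hb := Complex.le_def.mp (h1.diag_nonneg (i := i))
    simp at ha hb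
    exact ⟨ha.1, hb.1, ha.2.symm⟩
  have hdet := Complex.le_def.mp (h0.submatrix ![j, k]).det_nonneg
  rw [Matrix.det_fin_two] at hdet
  have hkj : A k j = star (A j k) := (h0.isHermitian.apply k j).symm
  simp [hkj, (hdiag j).2.2, (hdiag k).2.2] at hdet
  have hsq : ‖A j k‖ ^ 2 = (A j k).re * (A j k).re + (A j k).im * (A j k).im := by
    rw [← Complex.normSq_eq_norm_sq, Complex.normSq_apply]
  have hp : (A j j).re * (A k k).re ≤ 1 := by
    nlinarith [(hdiag j).1, (hdiag j).2.1, (hdiag k).1, (hdiag k).2.1]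
  have : ‖A j k‖ ^ 2 ≤ 1 := by linarith
  nlinarith [norm_nonneg (A j k)]

theorem continuous_matrix_exp :
    Continuous (NormedSpace.exp : Matrix (Fin n) (Fin n) ℂ → Matrix (Fin n) (Fin n) ℂ) := by
  let _ : NormedRing (Matrix (Fin n) (Fin n) ℂ) := Matrix.linftyOpNormedRing
  let _ : NormedAlgebra ℂ (Matrix (Fin n) (Fin n) ℂ) := Matrix.linftyOpNormedAlgebra
  let _ : NormedAlgebra ℚ (Matrix (Fin n) (Fin n) ℂ) := NormedAlgebra.restrictScalars ℚ ℂ _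
  exact NormedSpace.exp_continuous

/-- The exponential of a matrix with imaginary part `π` is minus that of its real part,
hence Hermitian. -/
theorem isHermitian_exp_of_sub_conjTranspose {A : Matrix (Fin n) (Fin n) ℂ}
    (h : A - Aᴴ = (2 * Real.pi * Complex.I) • 1) : (NormedSpace.exp A).IsHermitian := by
  set H : Matrix (Fin n) (Fin n) ℂ := A - (Real.pi * Complex.I) • 1 with hH
  have hherm : H.IsHermitian := by
    rw [Matrix.IsHermitian, hH, Matrix.conjTranspose_sub, Matrix.conjTranspose_smul,
      Matrix.conjTranspose_one]
    have h1 : star ((Real.pi : ℂ) * Complex.I) = -(Real.pi * Complex.I) := by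
      simp
    have h2 : Aᴴ = A - (2 * Real.pi * Complex.I) • 1 := by rw [← h, sub_sub_cancel]
    rw [h1, h2, sub_sub, ← add_smul]
    congr 2
    ring
  have hexp : NormedSpace.exp ((Real.pi * Complex.I) • (1 : Matrix (Fin n) (Fin n) ℂ)) = -1 := by
    rw [Matrix.smul_one_eq_diagonal, Matrix.exp_diagonal]
    have : NormedSpace.exp (fun _ : Fin n => (Real.pi : ℂ) * Complex.I) = fun _ => -1 := by
      ext i
      rw [Pi.coe_exp, ← Complex.exp_eq_exp_ℂ, Complex.exp_pi_mul_I]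
    rw [this, ← Matrix.diagonal_one, ← Matrix.diagonal_neg]
  have hA : A = H + (Real.pi * Complex.I) • 1 := by rw [hH, sub_add_cancel]
  rw [hA, Matrix.exp_add_of_commute _ _ ((Commute.one_right H).smul_right _), hexp, mul_neg,
    mul_one]
  exact hherm.exp.neg

end Matrices

/-! ### Boundary behaviour of Herglotz matrices -/

theorem tendsto_mul_const_nhdsGT_zero (r : ℝ) :
    Tendsto (fun ε : ℝ => ε * r) (𝓝[>] 0) (𝓝 0) := by
  have : Continuous fun ε : ℝ => ε * r := by fun_prop
  simpa using (this.tendsto 0).mono_left (nhdsWithin_le_nhds (s := Ioi 0))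

theorem tendsto_bdryPt (x : ℝ) : Tendsto (fun ε : ℝ => bdryPt x ε) (𝓝[>] 0) (𝓝 (x : ℂ)) := by
  have : Continuous fun ε : ℝ => bdryPt x ε := by unfold bdryPt; fun_prop
  have h := (this.tendsto 0).mono_left (nhdsWithin_le_nhds (s := Ioi 0))
  simpa [bdryPt] using h

namespace MatrixMeasure

variable {n : ℕ} {Ω : MatrixMeasure n}

/-- Limits of the four scalar Borel transforms that enter a matrix entry by polarization carry over
to the matrix. The scalar weight `c ε` serves for `c ε = 1` and for `c ε = ε`. -/
theorem exists_tendsto_smul_integral {c : ℝ → ℂ} {x : ℝ} {a : Fin n → Fin n → ℂ → ℂ}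
    (h : ∀ j k, ∀ s ∈ ({1, -1, Complex.I, -Complex.I} : Set ℂ), Tendsto (fun ε : ℝ =>
      c ε * borelTransform (Ω.quad (Pi.single j 1 + s • Pi.single k 1)) (bdryPt x ε))
      (𝓝[>] 0) (𝓝 (a j k s))) :
    ∃ A, Tendsto (fun ε : ℝ => c ε • Ω.integral (herglotzKernel (bdryPt x ε))) (𝓝[>] 0) (𝓝 A) ∧
      ((∀ j k s, a j k s = 0) → A = 0) := by
  refine ⟨Matrix.of fun j k => (1 / 4 : ℂ) * (a j k 1 - a j k (-1)
    + Complex.I * a j k (-Complex.I) - Complex.I * a j k Complex.I), ?_, ?_⟩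
  · refine tendsto_pi_nhds.mpr fun j => tendsto_pi_nhds.mpr fun k => ?_
    have h1 := h j k 1 (by simp)
    have h2 := h j k (-1) (by simp)
    have h3 := h j k (-Complex.I) (by simp)
    have h4 := h j k Complex.I (by simp)
    refine ((((h1.sub h2).add (h3.const_mul Complex.I)).sub
      (h4.const_mul Complex.I)).const_mul (1 / 4 : ℂ)).congr fun ε => ?_
    simp only [MatrixMeasure.integral, borelTransform, Matrix.smul_apply, Matrix.of_apply,
      smul_eq_mul, one_smul, neg_smul, ← sub_eq_add_neg]
    ring
  · intro h0
    ext j k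
    simp [h0]

theorem integral_diag (f : ℝ → ℂ) (j : Fin n) :
    Ω.integral f j j = ∫ t, f t ∂(Ω.quad (Pi.single j 1)) := by
  have hs : ∀ c : ℂ, ∫ t, f t ∂(Ω.quad (c • Pi.single j 1))
      = ((‖c‖ ^ 2 : ℝ) : ℂ) * ∫ t, f t ∂(Ω.quad (Pi.single j 1)) := by
    intro c
    rw [Ω.quad_smul, integral_smul_measure, ENNReal.toReal_ofReal (by positivity),
      Complex.real_smul]
  set v : Fin n → ℂ := Pi.single j 1 with hv
  have h1 : v + v = (2 : ℂ) • v := (two_smul ℂ v).symm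
  have h2 : v - v = (0 : ℂ) • v := by simp
  have h3 : v - Complex.I • v = (1 - Complex.I) • v := by rw [sub_smul, one_smul]
  have h4 : v + Complex.I • v = (1 + Complex.I) • v := by rw [add_smul, one_smul]
  have n3 : ‖(1 - Complex.I : ℂ)‖ ^ 2 = 2 := by
    rw [← Complex.normSq_eq_norm_sq, Complex.normSq_apply]; norm_num
  have n4 : ‖(1 + Complex.I : ℂ)‖ ^ 2 = 2 := by
    rw [← Complex.normSq_eq_norm_sq, Complex.normSq_apply]; norm_num
  simp only [MatrixMeasure.integral, Matrix.of_apply, ← hv]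
  rw [h1, h2, h3, h4, hs, hs, hs, hs, n3, n4]
  simp only [Complex.norm_ofNat, norm_zero]
  push_cast
  ring

end MatrixMeasure

namespace HasHerglotzRepresentation

variable {n : ℕ} {M : ℂ → Matrix (Fin n) (Fin n) ℂ} {C D : Matrix (Fin n) (Fin n) ℂ}
  {Ω : MatrixMeasure n}

theorem integrable_quad (hΩ : HasHerglotzRepresentation M C D Ω) (x : Fin n → ℂ) :
    Integrable (fun t : ℝ => (1 + t ^ 2)⁻¹) (Ω.quad x) := by
  have hm : Measurable fun t : ℝ => (1 + t ^ 2)⁻¹ := by fun_prop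
  refine ⟨hm.aestronglyMeasurable, ?_⟩
  rw [hasFiniteIntegral_iff_ofReal (Eventually.of_forall fun t => by positivity)]
  exact hΩ.lintegral_lt_top x

theorem integrable_trace (hΩ : HasHerglotzRepresentation M C D Ω) :
    Integrable (fun t : ℝ => (1 + t ^ 2)⁻¹) Ω.trace := by
  rw [MatrixMeasure.trace, integrable_finsetSum_measure]
  exact fun j _ => hΩ.integrable_quad _

theorem trace_eq (hΩ : HasHerglotzRepresentation M C D Ω) {z : ℂ} (hz : 0 < z.im) :
    (M z).trace = C.trace + z * D.trace + borelTransform Ω.trace z := by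
  rw [hΩ.eq_integral z hz, Matrix.trace_add, Matrix.trace_add, Matrix.trace_smul, smul_eq_mul,
    borelTransform, MatrixMeasure.trace, integral_finsetSum_measure
      (fun j _ => integrable_herglotzKernel (hΩ.integrable_quad _) hz)]
  simp only [Matrix.trace, Matrix.diag_apply, MatrixMeasure.integral_diag]

theorem trace_im_eq (hΩ : HasHerglotzRepresentation M C D Ω) (x : ℝ) {ε : ℝ} (hε : 0 < ε) :
    (M (bdryPt x ε)).trace.im = ε * D.trace.re + (borelTransform Ω.trace (bdryPt x ε)).im := by
  have him : ∀ A : Matrix (Fin n) (Fin n) ℂ, A.IsHermitian → A.trace.im = 0 := by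
    intro A hA
    have := trace_matIm A
    rw [matIm_eq_zero_iff.mpr hA, Matrix.trace_zero] at this
    exact_mod_cast this.symm
  have hC : C.trace.im = 0 := him C (hΩ.C_eq ▸ isHermitian_matRe _)
  have hD : D.trace.im = 0 := him D hΩ.D_posSemidef.isHermitian
  rw [hΩ.trace_eq (by rwa [bdryPt_im]), Complex.add_im, Complex.add_im, Complex.mul_im, hC, hD,
    bdryPt_im, mul_zero, zero_add, zero_add]

theorem ae_tendsto_trace_im (hΩ : HasHerglotzRepresentation M C D Ω) :
    ∀ᵐ x : ℝ, Tendsto (fun ε : ℝ => (M (bdryPt x ε)).trace.im) (𝓝[>] 0)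
      (𝓝 (Real.pi * (Ω.trace.rnDeriv volume x).toReal)) := by
  filter_upwards [ae_tendsto_borelTransform_im hΩ.integrable_trace] with x hx
  have h1 := (tendsto_mul_const_nhdsGT_zero D.trace.re).add hx
  rw [zero_add] at h1
  refine h1.congr' ?_
  filter_upwards [self_mem_nhdsWithin] with ε hε
  exact (hΩ.trace_im_eq x hε).symm

theorem ae_restrict_mem_suppS (hΩ : HasHerglotzRepresentation M C D Ω) :
    ∀ᵐ x ∂(Ω.trace.restrict Ω.singularCarrier), x ∈ suppS M := by
  filter_upwards [ae_restrict_tendsto_borelTransform_im_atTop hΩ.integrable_trace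
    Ω.volume_singularCarrier] with x hx
  refine Tendsto.congr' ?_ ((tendsto_mul_const_nhdsGT_zero D.trace.re).add_atTop hx)
  filter_upwards [self_mem_nhdsWithin] with ε hε
  exact (hΩ.trace_im_eq x hε).symm

theorem volume_suppS (hΩ : HasHerglotzRepresentation M C D Ω) : volume (suppS M) = 0 := by
  rw [measure_eq_zero_iff_ae_notMem]
  filter_upwards [hΩ.ae_tendsto_trace_im] with x hx hxS
  exact not_tendsto_nhds_of_tendsto_atTop hxS _ hx

theorem ae_exists_tendsto (hΩ : HasHerglotzRepresentation M C D Ω) :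
    ∀ᵐ x : ℝ, ∃ A, Tendsto (fun ε : ℝ => M (bdryPt x ε)) (𝓝[>] 0) (𝓝 A) := by
  have h : ∀ᵐ x : ℝ, ∀ j k : Fin n, ∀ s ∈ ({1, -1, Complex.I, -Complex.I} : Set ℂ), ∃ a, Tendsto
      (fun ε : ℝ => borelTransform (Ω.quad (Pi.single j 1 + s • Pi.single k 1)) (bdryPt x ε))
      (𝓝[>] 0) (𝓝 a) :=
    ae_all_iff.mpr fun j => ae_all_iff.mpr fun k => (ae_ball_iff (toFinite _).countable).mpr
      fun s _ => ae_exists_tendsto_borelTransform (hΩ.integrable_quad _)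
  filter_upwards [h] with x hx
  have hx' : ∀ j k s, ∃ a, s ∈ ({1, -1, Complex.I, -Complex.I} : Set ℂ) → Tendsto
      (fun ε : ℝ => 1 * borelTransform (Ω.quad (Pi.single j 1 + s • Pi.single k 1)) (bdryPt x ε))
      (𝓝[>] 0) (𝓝 a) := by
    intro j k s
    by_cases hs : s ∈ ({1, -1, Complex.I, -Complex.I} : Set ℂ)
    · obtain ⟨a, ha⟩ := hx j k s hs
      exact ⟨a, fun _ => by simpa only [one_mul] using ha⟩
    · exact ⟨0, fun h => absurd h hs⟩
  choose a ha using hx'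
  obtain ⟨A, hA, -⟩ := MatrixMeasure.exists_tendsto_smul_integral (c := fun _ => 1) ha
  refine ⟨C + (x : ℂ) • D + A, ((((tendsto_bdryPt x).smul_const D).const_add C).add hA).congr' ?_⟩
  filter_upwards [self_mem_nhdsWithin] with ε hε
  rw [hΩ.eq_integral _ (by rw [bdryPt_im]; exact hε), one_smul]

theorem tendsto_mul_trace (hΩ : HasHerglotzRepresentation M C D Ω) (x : ℝ) :
    Tendsto (fun ε : ℝ => (ε : ℂ) * (M (bdryPt x ε)).trace) (𝓝[>] 0)
      (𝓝 (Complex.I * (Ω.trace {x}).toReal)) := by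
  have hε0 : Tendsto (fun ε : ℝ => (ε : ℂ)) (𝓝[>] 0) (𝓝 0) :=
    (Complex.continuous_ofReal.tendsto 0).mono_left nhdsWithin_le_nhds
  have h1 := (hε0.mul (((tendsto_bdryPt x).mul_const D.trace).const_add C.trace)).add
    (tendsto_mul_borelTransform hΩ.integrable_trace x)
  rw [zero_mul, zero_add] at h1
  refine h1.congr' ?_
  filter_upwards [self_mem_nhdsWithin] with ε hε
  rw [hΩ.trace_eq (by rw [bdryPt_im]; exact hε), mul_add _ (_ + _)]

/-- The limit of `ε M(x + iε)` exists at every point, and it vanishes exactly off the atoms. -/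
theorem exists_tendsto_smul (hΩ : HasHerglotzRepresentation M C D Ω) (x : ℝ) :
    ∃ A, Tendsto (fun ε : ℝ => (ε : ℂ) • M (bdryPt x ε)) (𝓝[>] 0) (𝓝 A) ∧
      (A ≠ 0 ↔ x ∈ Ω.atoms) := by
  have hε0 : Tendsto (fun ε : ℝ => (ε : ℂ)) (𝓝[>] 0) (𝓝 0) :=
    (Complex.continuous_ofReal.tendsto 0).mono_left nhdsWithin_le_nhds
  obtain ⟨A, hA, hA0⟩ := MatrixMeasure.exists_tendsto_smul_integral
    (Ω := Ω) (c := fun ε : ℝ => (ε : ℂ)) (x := x)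
    fun j k s _ => tendsto_mul_borelTransform
      (hΩ.integrable_quad (Pi.single j 1 + s • Pi.single k 1)) x
  have hlim : Tendsto (fun ε : ℝ => (ε : ℂ) • M (bdryPt x ε)) (𝓝[>] 0) (𝓝 A) := by
    have h1 := (hε0.smul (((tendsto_bdryPt x).smul_const D).const_add C)).add hA
    rw [zero_smul, zero_add] at h1
    refine h1.congr' ?_
    filter_upwards [self_mem_nhdsWithin] with ε hε
    rw [hΩ.eq_integral _ (by rw [bdryPt_im]; exact hε), smul_add _ (_ + _)]
  refine ⟨A, hlim, ?_⟩
  have := isLocallyFiniteMeasure_of_integrable hΩ.integrable_trace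
  constructor
  · intro hne hx
    refine hne (hA0 fun j k s => ?_)
    rw [Ω.quad_apply _ (measurableSet_singleton x) Bornology.isBounded_singleton, hx]
    simp [quadForm]
  · rintro hx rfl
    have h1 : Tendsto (fun ε : ℝ => ((ε : ℂ) • M (bdryPt x ε)).trace) (𝓝[>] 0)
        (𝓝 (0 : Matrix (Fin n) (Fin n) ℂ).trace) :=
      (Continuous.tendsto (by fun_prop : Continuous
        fun B : Matrix (Fin n) (Fin n) ℂ => B.trace) _).comp hlim
    simp_rw [Matrix.trace_smul, smul_eq_mul] at h1
    have h2 := tendsto_nhds_unique (hΩ.tendsto_mul_trace x) h1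
    rw [Matrix.trace_zero, mul_eq_zero, or_iff_right Complex.I_ne_zero, Complex.ofReal_eq_zero,
      ENNReal.toReal_eq_zero_iff, or_iff_left isCompact_singleton.measure_lt_top.ne] at h2
    exact Ω.mem_atoms_iff.mp hx h2

theorem suppPP_eq (hΩ : HasHerglotzRepresentation M C D Ω) : suppPP M = Ω.atoms := by
  ext x
  obtain ⟨A, hA, hA0⟩ := hΩ.exists_tendsto_smul x
  rw [mem_suppPP_iff, ← hA0]
  constructor
  · rintro ⟨B, hB, hB0⟩
    rwa [tendsto_nhds_unique hA hB]
  · exact fun h => ⟨A, hA, h⟩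

/-- Up to a Lebesgue null set, `S_ac` is the set where the density of the trace measure is not zero.
As the imaginary part of a boundary value is nonnegative, it vanishes if its trace does. -/
theorem ae_mem_suppAC_iff (hΩ : HasHerglotzRepresentation M C D Ω) (hM : IsHerglotzMatrix M) :
    ∀ᵐ x : ℝ, x ∈ suppAC M ↔ Ω.trace.rnDeriv volume x ≠ 0 := by
  have := isLocallyFiniteMeasure_of_integrable hΩ.integrable_trace
  filter_upwards [hΩ.ae_exists_tendsto, hΩ.ae_tendsto_trace_im,
    Measure.rnDeriv_lt_top Ω.trace volume] with x ⟨A, hA⟩ htr hfin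
  have h1 : Tendsto (fun ε : ℝ => (M (bdryPt x ε)).trace.im) (𝓝[>] 0) (𝓝 A.trace.im) :=
    (Continuous.tendsto (by fun_prop : Continuous
      fun B : Matrix (Fin n) (Fin n) ℂ => B.trace.im) A).comp hA
  have hpsd : (matIm A).PosSemidef := by
    refine posSemidef_of_tendsto ((continuous_matIm.tendsto A).comp hA) ?_
    filter_upwards [self_mem_nhdsWithin] with ε hε
    exact hM.2 _ (by rw [bdryPt_im]; exact hε)
  have h2 : matIm A ≠ 0 ↔ Ω.trace.rnDeriv volume x ≠ 0 := by
    rw [not_iff_not, ← hpsd.trace_eq_zero_iff, trace_matIm, Complex.ofReal_eq_zero,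
      tendsto_nhds_unique h1 htr, mul_eq_zero, or_iff_right Real.pi_ne_zero,
      ENNReal.toReal_eq_zero_iff, or_iff_left hfin.ne]
  rw [mem_suppAC_iff, ← h2]
  constructor
  · rintro ⟨B, hB, hB0⟩
    rwa [tendsto_nhds_unique hA hB]
  · exact fun h => ⟨A, hA, h⟩

theorem isMinimalSupport_suppSC (hΩ : HasHerglotzRepresentation M C D Ω) :
    Ω.scPart.IsMinimalSupport (suppSC M) := by
  have hA := Ω.countable_atoms.measurableSet
  have hm := Ω.measurableSet_singularCarrier.diff hA
  refine ⟨?_, fun T _ _ => ?_⟩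
  · rw [MatrixMeasure.isSupport_iff, MatrixMeasure.scPart, MatrixMeasure.trace_restrict]
    change ∀ᵐ x ∂(Ω.trace.restrict (Ω.singularCarrier \ Ω.atoms)), x ∈ suppSC M
    filter_upwards [ae_mono (Measure.restrict_mono_set Ω.trace sdiff_subset)
      hΩ.ae_restrict_mem_suppS, ae_restrict_mem hm] with x hx hxm
    refine ⟨hx, ?_⟩
    have h1 := hΩ.tendsto_mul_trace x
    have h0 : Ω.trace {x} = 0 := by
      by_contra h
      exact hxm.2 (Ω.mem_atoms_iff.mpr h)
    simpa [h0] using h1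
  · exact measure_mono_null (fun x hx => hx.1.1) hΩ.volume_suppS

theorem isSmallestSupport_suppPP (hΩ : HasHerglotzRepresentation M C D Ω) :
    Ω.ppPart.IsSmallestSupport (suppPP M) := by
  have hA := Ω.countable_atoms.measurableSet
  rw [hΩ.suppPP_eq]
  refine ⟨?_, fun T hT x hx => ?_⟩
  · rw [MatrixMeasure.isSupport_iff, MatrixMeasure.ppPart, MatrixMeasure.trace_restrict,
      Measure.restrict_apply hA.compl, compl_inter_self, measure_empty]
  · by_contra hxT
    rw [MatrixMeasure.isSupport_iff, MatrixMeasure.ppPart, MatrixMeasure.trace_restrict] at hT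
    have h1 : Ω.trace.restrict Ω.atoms {x} = 0 :=
      measure_mono_null (singleton_subset_iff.mpr hxT) hT
    rw [Measure.restrict_apply (measurableSet_singleton x),
      inter_eq_left.mpr (singleton_subset_iff.mpr hx)] at h1
    exact Ω.mem_atoms_iff.mp hx h1

theorem isMinimalSupport_suppAll (hΩ : HasHerglotzRepresentation M C D Ω)
    (hM : IsHerglotzMatrix M) : Ω.IsMinimalSupport (suppAll M) := by
  have hac := Ω.isMinimalSupport_acPart (hΩ.ae_mem_suppAC_iff hM)
  refine ⟨?_, fun T _ hT => ?_⟩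
  · rw [MatrixMeasure.isSupport_iff, Ω.trace_eq_add, Measure.add_apply, add_eq_zero]
    constructor
    · have h := hΩ.ae_restrict_mem_suppS
      exact measure_mono_null (compl_subset_compl.mpr subset_union_right) h
    · exact measure_mono_null (compl_subset_compl.mpr subset_union_left)
        ((MatrixMeasure.isSupport_iff _).mp hac.1)
  · rw [MatrixMeasure.isSupport_iff, Ω.trace_eq_add, Measure.add_apply, add_eq_zero,
      MatrixMeasure.trace_acPart_eq_zero_iff] at hT
    rw [measure_eq_zero_iff_ae_notMem]
    filter_upwards [hΩ.ae_mem_suppAC_iff hM, hT.2,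
      measure_eq_zero_iff_ae_notMem.mp hΩ.volume_suppS] with x hx hxT hxS hxST
    rcases hxST.1 with h | h
    · exact hx.mp h (hxT hxST.2)
    · exact hxS h

end HasHerglotzRepresentation

/-! ### The exponential representation -/

/-- Almost everywhere the logarithm has a boundary value `A`, and its imaginary part is `π Ξ`. -/
theorem HasExponentialRepresentation.ae_exists_tendsto_log {n : ℕ}
    {M : ℂ → Matrix (Fin n) (Fin n) ℂ} {K : Matrix (Fin n) (Fin n) ℂ}
    {Ξ : ℝ → Matrix (Fin n) (Fin n) ℂ} (h : HasExponentialRepresentation M K Ξ) :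
    ∀ᵐ x : ℝ, ∃ (L : ℝ → Matrix (Fin n) (Fin n) ℂ) (A : Matrix (Fin n) (Fin n) ℂ),
      (∀ ε : ℝ, 0 < ε → IsMatLog (M (bdryPt x ε)) (L ε)) ∧ Tendsto L (𝓝[>] 0) (𝓝 A) ∧
      A - Aᴴ = (2 * Real.pi * Complex.I) • Ξ x := by
  have hK : K.IsHermitian := by
    obtain ⟨L, -, rfl⟩ := h.K_eq
    exact isHermitian_matRe L
  have hb : ∀ j k, ∀ᵐ t, ‖Ξ t j k‖ ≤ 1 := by
    intro j k
    filter_upwards [h.nonneg, h.le_one] with t h0 h1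
    exact norm_entry_le_one h0 h1 j k
  have hall : ∀ᵐ x : ℝ, ∀ j k, ∃ a b : ℂ,
      Tendsto (fun ε : ℝ => ∫ t : ℝ, Ξ t j k * herglotzKernel (bdryPt x ε) t) (𝓝[>] 0) (𝓝 a) ∧
      Tendsto (fun ε : ℝ => ∫ t : ℝ, Ξ t j k * (starRingEnd ℂ) (herglotzKernel (bdryPt x ε) t))
        (𝓝[>] 0) (𝓝 b) ∧ a - b = 2 * Real.pi * Complex.I * Ξ x j k :=
    ae_all_iff.mpr fun j => ae_all_iff.mpr fun k =>
      ae_exists_tendsto_integral_complex (h.aestronglyMeasurable j k) (hb j k)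
  filter_upwards [hall] with x hx
  choose a b ha hb hab using hx
  refine ⟨fun ε => K + Matrix.of fun j k => ∫ t : ℝ, Ξ t j k * herglotzKernel (bdryPt x ε) t,
    K + Matrix.of a, fun ε hε => h.log_eq_integral _ (by rwa [bdryPt_im]), ?_, ?_⟩
  · exact Tendsto.const_add K (tendsto_pi_nhds.mpr fun j => tendsto_pi_nhds.mpr fun k => ha j k)
  -- as `Ξ` is Hermitian, conjugation turns the `(k, j)` entry into the conjugate transform of the
  -- `(j, k)` entry
  have hconj : ∀ j k, (starRingEnd ℂ) (a k j) = b j k := by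
    intro j k
    refine tendsto_nhds_unique ((Complex.continuous_conj.tendsto _).comp (ha k j))
      ((hb j k).congr fun ε => ?_)
    simp only [Function.comp_apply]
    rw [← integral_conj]
    refine integral_congr_ae ?_
    filter_upwards [h.nonneg] with t ht
    rw [map_mul]
    congr 1
    exact (ht.isHermitian.apply j k).symm
  ext j k
  rw [Matrix.conjTranspose_add, hK.eq, add_sub_add_left_eq_sub, Matrix.sub_apply,
    Matrix.conjTranspose_apply, Matrix.of_apply, Matrix.of_apply, Matrix.smul_apply, smul_eq_mul,
    ← hab j k, ← hconj j k]
  rfl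

/-- Where `tr Ξ = 0` or `tr Ξ = n`, the boundary value of the logarithm is Hermitian up to adding
`πi`, so that of `M` is Hermitian and the point is not in `S_ac`. -/
theorem HasExponentialRepresentation.ae_mem_suppACTilde_iff {n : ℕ}
    {M : ℂ → Matrix (Fin n) (Fin n) ℂ} {K : Matrix (Fin n) (Fin n) ℂ}
    {Ξ : ℝ → Matrix (Fin n) (Fin n) ℂ} (h : HasExponentialRepresentation M K Ξ) :
    ∀ᵐ x : ℝ, x ∈ suppACTilde M Ξ ↔ x ∈ suppAC M := by
  filter_upwards [h.ae_exists_tendsto_log, h.nonneg, h.le_one] with x ⟨L, A, hL, hLA, hA⟩ h0 h1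
  refine ⟨fun hx => hx.1, fun hx => ⟨hx, ⟨L, A, hL, hLA⟩, ?_⟩⟩
  obtain ⟨B, hB, hB0⟩ := mem_suppAC_iff.mp hx
  have hAB : NormedSpace.exp A = B := by
    refine tendsto_nhds_unique (((continuous_matrix_exp.tendsto A).comp hLA).congr' ?_) hB
    filter_upwards [self_mem_nhdsWithin] with ε hε
    exact (hL ε hε).1
  have hherm : ¬ (NormedSpace.exp A).IsHermitian := fun hh =>
    hB0 (matIm_eq_zero_iff.mpr (hAB ▸ hh))
  have hzero : ∀ P : Matrix (Fin n) (Fin n) ℂ, P.PosSemidef → P.trace.re ≤ 0 → P = 0 := by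
    intro P hP hle
    have hp := Complex.le_def.mp hP.trace_nonneg
    exact hP.trace_eq_zero_iff.mp (Complex.ext (le_antisymm hle hp.1) hp.2.symm)
  constructor
  · by_contra! hle
    rw [hzero _ h0 hle, smul_zero, sub_eq_zero] at hA
    exact hherm (Matrix.IsHermitian.exp hA.symm)
  · by_contra! hge
    have h2 : (1 - Ξ x).trace.re ≤ 0 := by
      rw [Matrix.trace_sub, Matrix.trace_one, Fintype.card_fin, Complex.sub_re, Complex.natCast_re]
      linarith
    rw [← sub_eq_zero.mp (hzero _ h1 h2)] at hA
    exact hherm (isHermitian_exp_of_sub_conjTranspose hA)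

theorem theorem6p1 {n : ℕ} (M : ℂ → Matrix (Fin n) (Fin n) ℂ) (hM : IsHerglotzMatrix M)
    (C D : Matrix (Fin n) (Fin n) ℂ) (Ω : MatrixMeasure n)
    (hΩ : HasHerglotzRepresentation M C D Ω) :
    Ω.acPart.IsMinimalSupport (suppAC M) ∧
    Ω.scPart.IsMinimalSupport (suppSC M) ∧
    Ω.ppPart.IsSmallestSupport (suppPP M) ∧
    Ω.IsMinimalSupport (suppAll M) ∧
    ((∀ z : ℂ, 0 < z.im → IsUnit (M z)) →
      ∀ (K : Matrix (Fin n) (Fin n) ℂ) (Ξ : ℝ → Matrix (Fin n) (Fin n) ℂ),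
        HasExponentialRepresentation M K Ξ → Ω.acPart.IsMinimalSupport (suppACTilde M Ξ)) := by
  refine ⟨Ω.isMinimalSupport_acPart (hΩ.ae_mem_suppAC_iff hM), hΩ.isMinimalSupport_suppSC,
    hΩ.isSmallestSupport_suppPP, hΩ.isMinimalSupport_suppAll hM, fun _ K Ξ hΞ => ?_⟩
  refine Ω.isMinimalSupport_acPart ?_
  filter_upwards [hΞ.ae_mem_suppACTilde_iff, hΩ.ae_mem_suppAC_iff hM] with x h1 h2
  exact h1.trans h2
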